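/- Let $\lambda$ be Lebesgue measure on $[0,1]$. Let Weak$L^1$ be the vector lattice of a.e.-equivalence classes of real measurable functions $f$ on $[0,1]$ with $q(f)=\sup_{c>0}c\,\lambda\{|f|>c\}<\infty$, let $\rho$ be the gauge functional of the convex hull of $\{f: q(f)\le 1\}$, let $N=\{f:\rho(f)=0\}$, and let $W=(\mathrm{Weak}L^1/N,\rho)$, with the quotient lattice structure, be the normed envelope of Weak$L^1$. Let $(\Omega,\mu)$ be one of $[0,\infty)$, $[0,1]$ (with Lebesgue measure) or $\mathbb N$ (with counting measure). A *Köthe function space* on $\Omega$ is a Banach space $X$ of a.e.-equivalence classes of real measurable functions on $\Omega$, integrable over every set of finite measure, such that (1) if $f$ is measurable, $g\in X$ and $|f|\le|g|$ a.e., then $f\in X$ and $\|f\|\le\|g\|$; (2) $\chi_A\in X$ whenever $\mu(A)<\infty$. Its Köthe dual $X'$ consists of all measurable $g$ such that $fg$ is integrable for all $f\in X$, normed as a subspace of $X^*$ through $f\mapsto\int fg\,d\mu$; put $X''=(X')'$. The space $X$ is *rearrangement invariant* (in the sense of Lindenstrauss–Tzafriri) if (i) for every measure preserving automorphism $\tau$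 of $\Omega$ and every measurable $f$, $f\in X$ if and only if $f\circ\tau\in X$, and then $\|f\circ\tau\|=\|f\|$; (ii) $X'$ is norming, i.e. $\|f\|=\sup\{|\int fg\,d\mu|:\|g\|_{X'}\le1\}$ for all $f\in X$, and either $X=X''$ or $X$ is the closed linear span in $X''$ of the simple integrable functions; (iii) the following inclusions hold and have norm at most one: $L^1\cap L^\infty\subseteq X\subseteq L^1+L^\infty$ if $\Omega=[0,\infty)$ (with the norms $\max(\|f\|_1,\|f\|_\infty)$ and $\inf\{\|g\|_1+\|h\|_\infty:f=g+h\}$); $L^\infty\subseteq X\subseteq L^1$ if $\Omega=[0,1]$; $\ell^1\subseteq X\subseteq\ell^\infty$ if $\Omega=\mathbb N$. **Theorem.** Every rearrangement invariant space on $[0,\infty)$, on $[0,1]$ or on $\mathbb N$, with the a.e. pointwise order, is isometrically lattice isomorphic to a sublattice of $W$. -/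

import Mathlib

open MeasureTheory Set
open scoped ENNReal unitInterval

noncomputable section

/-! ## Weak `L¹` and its normed envelope -/

section WeakL1

variable {Ω : Type*} [MeasurableSpace Ω]

/-- The quasinorm `q(f) = sup_{c > 0} c μ{|f| > c}`. -/
def weakQuasiNorm (μ : Measure Ω) (f : Ω →ₘ[μ] ℝ) : ℝ≥0∞ :=
  ⨆ (c : ℝ) (_ : 0 < c), ENNReal.ofReal c * μ {x | c < |f x|}

variable {μ : Measure Ω}

theorem weakQuasiNorm_mono {f g : Ω →ₘ[μ] ℝ} (h : |f| ≤ |g|) :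
    weakQuasiNorm μ f ≤ weakQuasiNorm μ g := by
  refine iSup₂_mono fun c _ => mul_le_mul_right ?_ _
  refine measure_mono_ae ?_
  filter_upwards [AEEqFun.coeFn_le.2 h, AEEqFun.coeFn_abs f, AEEqFun.coeFn_abs g] with x h1 h2 h3
  intro hx
  rw [h2, h3] at h1
  exact lt_of_lt_of_le hx h1

theorem weakQuasiNorm_smul (a : ℝ) (f : Ω →ₘ[μ] ℝ) :
    weakQuasiNorm μ (a • f) ≤ ENNReal.ofReal |a| * weakQuasiNorm μ f := by
  refine iSup₂_le fun c hc => ?_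
  rcases eq_or_ne a 0 with rfl | ha
  · have : μ {x | c < |((0 : ℝ) • f : Ω →ₘ[μ] ℝ) x|} = 0 := by
      refine measure_mono_null_ae ?_ (measure_empty (μ := μ))
      filter_upwards [AEEqFun.coeFn_smul (0 : ℝ) f] with x hx hcx
      have hcx' : c < |((0 : ℝ) • f : Ω →ₘ[μ] ℝ) x| := hcx
      rw [hx] at hcx'
      simp at hcx'
      linarith
    rw [this]; simp
  · have ha' : 0 < |a| := abs_pos.2 ha
    have h1 : μ {x | c < |(a • f : Ω →ₘ[μ] ℝ) x|} ≤ μ {x | c / |a| < |f x|} := by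
      refine measure_mono_ae ?_
      filter_upwards [AEEqFun.coeFn_smul a f] with x hx hcx
      have hcx' : c < |(a • f : Ω →ₘ[μ] ℝ) x| := hcx
      rw [hx] at hcx'
      simp only [Pi.smul_apply, smul_eq_mul, abs_mul] at hcx'
      change c / |a| < |f x|
      rwa [div_lt_iff₀' ha']
    have h2 : ENNReal.ofReal c = ENNReal.ofReal |a| * ENNReal.ofReal (c / |a|) := by
      rw [← ENNReal.ofReal_mul ha'.le]; congr 1; field_simp
    calc ENNReal.ofReal c * μ {x | c < |(a • f : Ω →ₘ[μ] ℝ) x|}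
        ≤ ENNReal.ofReal c * μ {x | c / |a| < |f x|} := by gcongr
      _ = ENNReal.ofReal |a| * (ENNReal.ofReal (c / |a|) * μ {x | c / |a| < |f x|}) := by
        rw [h2, mul_assoc]
      _ ≤ _ := by
        gcongr
        exact le_iSup₂ (f := fun (c : ℝ) (_ : 0 < c) => ENNReal.ofReal c * μ {x | c < |f x|})
          (c / |a|) (by positivity)

theorem weakQuasiNorm_le_of_abs_le_add {f g h : Ω →ₘ[μ] ℝ}
    (H : ∀ᵐ x ∂μ, |h x| ≤ |f x| + |g x|) :
    weakQuasiNorm μ h ≤ 2 * weakQuasiNorm μ f + 2 * weakQuasiNorm μ g := by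
  refine iSup₂_le fun c hc => ?_
  have h1 : μ {x | c < |h x|} ≤ μ {x | c / 2 < |f x|} + μ {x | c / 2 < |g x|} := by
    refine le_trans (measure_mono_ae ?_) (measure_union_le _ _)
    filter_upwards [H] with x hx hcx
    have hcx' : c < |h x| := hcx
    change c / 2 < |f x| ∨ c / 2 < |g x|
    by_contra! hh
    linarith [hh.1, hh.2]
  have h2 : ENNReal.ofReal c = 2 * ENNReal.ofReal (c / 2) := by
    rw [show (2 : ℝ≥0∞) = ENNReal.ofReal 2 by simp, ← ENNReal.ofReal_mul (by norm_num)]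
    congr 1; ring
  have key (k : Ω →ₘ[μ] ℝ) :
      ENNReal.ofReal (c / 2) * μ {x | c / 2 < |k x|} ≤ weakQuasiNorm μ k :=
    le_iSup₂ (f := fun (c : ℝ) (_ : 0 < c) => ENNReal.ofReal c * μ {x | c < |k x|})
      (c / 2) (by positivity)
  calc ENNReal.ofReal c * μ {x | c < |h x|}
      ≤ ENNReal.ofReal c * (μ {x | c / 2 < |f x|} + μ {x | c / 2 < |g x|}) := by gcongr
    _ = 2 * (ENNReal.ofReal (c / 2) * μ {x | c / 2 < |f x|})
        + 2 * (ENNReal.ofReal (c / 2) * μ {x | c / 2 < |g x|}) := by rw [h2]; ring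
    _ ≤ _ := by gcongr <;> exact key _

theorem weakQuasiNorm_lt_top_of_abs_le_add {f g h : Ω →ₘ[μ] ℝ}
    (hf : weakQuasiNorm μ f < ∞) (hg : weakQuasiNorm μ g < ∞)
    (H : ∀ᵐ x ∂μ, |h x| ≤ |f x| + |g x|) : weakQuasiNorm μ h < ∞ :=
  (weakQuasiNorm_le_of_abs_le_add H).trans_lt
    (ENNReal.add_lt_top.2 ⟨ENNReal.mul_lt_top (by simp) hf, ENNReal.mul_lt_top (by simp) hg⟩)

variable (μ) in
/-- The classes of measurable functions with finite weak `L¹` quasinorm. -/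
def weakL1Submodule : Submodule ℝ (Ω →ₘ[μ] ℝ) where
  carrier := {f | weakQuasiNorm μ f < ∞}
  zero_mem' := by
    have := weakQuasiNorm_smul (μ := μ) 0 0
    simp only [smul_zero, abs_zero, ENNReal.ofReal_zero, zero_mul] at this
    exact this.trans_lt (by simp)
  add_mem' := by
    intro f g hf hg
    refine weakQuasiNorm_lt_top_of_abs_le_add hf hg ?_
    filter_upwards [AEEqFun.coeFn_add f g] with x hx
    rw [hx]
    exact abs_add_le _ _
  smul_mem' := by
    intro a f hf
    exact (weakQuasiNorm_smul a f).trans_lt (ENNReal.mul_lt_top (by simp) hf)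

variable (μ) in
/-- The space Weak `L¹(μ)`. -/
def WeakL1 : Type _ := ↥(weakL1Submodule μ)

namespace WeakL1

instance : AddCommGroup (WeakL1 μ) := inferInstanceAs (AddCommGroup ↥(weakL1Submodule μ))
instance : Module ℝ (WeakL1 μ) := inferInstanceAs (Module ℝ ↥(weakL1Submodule μ))

theorem sup_mem {f g : Ω →ₘ[μ] ℝ} (hf : f ∈ weakL1Submodule μ) (hg : g ∈ weakL1Submodule μ) :
    f ⊔ g ∈ weakL1Submodule μ := by
  refine weakQuasiNorm_lt_top_of_abs_le_add hf hg ?_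
  filter_upwards [AEEqFun.coeFn_sup f g] with x hx
  rw [hx]
  rcases max_choice (f x) (g x) with h | h <;> rw [h] <;> linarith [abs_nonneg (f x), abs_nonneg (g x)]

theorem inf_mem {f g : Ω →ₘ[μ] ℝ} (hf : f ∈ weakL1Submodule μ) (hg : g ∈ weakL1Submodule μ) :
    f ⊓ g ∈ weakL1Submodule μ := by
  refine weakQuasiNorm_lt_top_of_abs_le_add hf hg ?_
  filter_upwards [AEEqFun.coeFn_inf f g] with x hx
  rw [hx]
  rcases min_choice (f x) (g x) with h | h <;> rw [h] <;> linarith [abs_nonneg (f x), abs_nonneg (g x)]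

/-- The almost everywhere pointwise lattice operations. -/
instance : Lattice (WeakL1 μ) :=
  Subtype.lattice (P := fun f => f ∈ weakL1Submodule μ) (fun _ _ => sup_mem) (fun _ _ => inf_mem)

variable (μ) in
/-- The unit ball of the quasinorm `q`. -/
def quasiBall : Set (WeakL1 μ) := {f | weakQuasiNorm μ f.1 ≤ 1}

theorem smul_mem_quasiBall {a : ℝ} (ha : |a| ≤ 1) {f : WeakL1 μ} (hf : f ∈ quasiBall μ) :
    a • f ∈ quasiBall μ := by
  refine (weakQuasiNorm_smul a f.1).trans ?_
  calc ENNReal.ofReal |a| * weakQuasiNorm μ f.1 ≤ 1 * 1 := by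
        gcongr
        · simpa using ENNReal.ofReal_le_ofReal ha
        · exact hf
    _ = 1 := by simp

theorem balanced_hull : Balanced ℝ (convexHull ℝ (quasiBall μ)) := by
  refine balanced_iff_smul_mem.2 fun a ha x hx => ?_
  have h1 : (LinearMap.lsmul ℝ (WeakL1 μ) a) '' convexHull ℝ (quasiBall μ)
      ⊆ convexHull ℝ (quasiBall μ) := by
    rw [LinearMap.image_convexHull]
    refine convexHull_mono ?_
    rintro _ ⟨y, hy, rfl⟩
    exact smul_mem_quasiBall (by simpa using ha) hy
  exact h1 ⟨x, hx, rfl⟩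

theorem absorbent_hull : Absorbent ℝ (convexHull ℝ (quasiBall μ)) := by
  refine Absorbent.mono ?_ (subset_convexHull ℝ _)
  intro x
  have hx : weakQuasiNorm μ x.1 < ∞ := x.2
  rw [absorbs_iff_norm]
  refine ⟨(weakQuasiNorm μ x.1).toReal + 1, fun c hc => ?_⟩
  have hq := ENNReal.toReal_nonneg (a := weakQuasiNorm μ x.1)
  rw [Real.norm_eq_abs] at hc
  have hc0 : 0 < |c| := by linarith
  have hcne : c ≠ 0 := abs_pos.1 hc0
  rw [singleton_subset_iff, mem_smul_set_iff_inv_smul_mem₀ hcne]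
  refine (weakQuasiNorm_smul _ _).trans ?_
  rw [abs_inv, ENNReal.ofReal_inv_of_pos hc0]
  rw [mul_comm, ← div_eq_mul_inv]
  refine ENNReal.div_le_of_le_mul ?_
  rw [one_mul, ← ENNReal.ofReal_toReal hx.ne]
  exact ENNReal.ofReal_le_ofReal (by linarith)

variable (μ) in
/-- The seminorm `ρ`: the gauge functional of the convex hull of `{f : q(f) ≤ 1}`. -/
def rho : Seminorm ℝ (WeakL1 μ) :=
  gaugeSeminorm balanced_hull (convex_convexHull ℝ (quasiBall μ)) absorbent_hull

instance : SeminormedAddCommGroup (WeakL1 μ) :=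
  AddGroupSeminorm.toSeminormedAddCommGroup (rho μ).toAddGroupSeminorm

theorem norm_eq_gauge (f : WeakL1 μ) : ‖f‖ = gauge (convexHull ℝ (quasiBall μ)) f := rfl

instance : NormedSpace ℝ (WeakL1 μ) where
  norm_smul_le a f := (map_smul_eq_mul (rho μ) a f).le

theorem norm_mono_of_ae {f g : WeakL1 μ} (h : ∀ᵐ x ∂μ, |f.1 x| ≤ |g.1 x|) : ‖f‖ ≤ ‖g‖ := by
  -- Multiplication by the measurable function `f / g`, bounded by one, keeps the ball stable.
  let m : Ω → ℝ := fun x => max (-1) (min 1 (f.1 x / g.1 x))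
  have hm : AEStronglyMeasurable m μ := by
    have : AEMeasurable m μ :=
      (aemeasurable_const.max (aemeasurable_const.min
        (f.1.aestronglyMeasurable.aemeasurable.div g.1.aestronglyMeasurable.aemeasurable)))
    exact this.aestronglyMeasurable
  have hm1 : ∀ x, |m x| ≤ 1 := fun x =>
    abs_le.2 ⟨le_max_left _ _, max_le (by norm_num) (min_le_left _ _)⟩
  let M : Ω →ₘ[μ] ℝ := AEEqFun.mk m hm
  have hmul (k : Ω →ₘ[μ] ℝ) : ⇑(M * k) =ᵐ[μ] fun x => m x * k x := by
    filter_upwards [AEEqFun.coeFn_mul M k, AEEqFun.coeFn_mk m hm] with x h1 h2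
    rw [h1, Pi.mul_apply, h2]
  have hq (k : Ω →ₘ[μ] ℝ) : weakQuasiNorm μ (M * k) ≤ weakQuasiNorm μ k := by
    refine weakQuasiNorm_mono (AEEqFun.coeFn_le.1 ?_)
    filter_upwards [AEEqFun.coeFn_abs (M * k), AEEqFun.coeFn_abs k, hmul k] with x h1 h2 h3
    rw [h1, h2, h3, abs_mul]
    exact mul_le_of_le_one_left (abs_nonneg _) (hm1 x)
  let L : WeakL1 μ →ₗ[ℝ] WeakL1 μ :=
    { toFun := fun k => ⟨M * k.1, (hq k.1).trans_lt k.2⟩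
      map_add' := fun k l => Subtype.ext <| by
        change M * (k.1 + l.1) = M * k.1 + M * l.1
        refine AEEqFun.ext ?_
        filter_upwards [hmul (k.1 + l.1), hmul k.1, hmul l.1, AEEqFun.coeFn_add k.1 l.1,
          AEEqFun.coeFn_add (M * k.1) (M * l.1)] with x h1 h2 h3 h4 h5
        rw [h1, h5, Pi.add_apply, h2, h3, h4, Pi.add_apply, mul_add]
      map_smul' := fun a k => Subtype.ext <| by
        change M * (a • k.1) = a • (M * k.1)
        refine AEEqFun.ext ?_
        filter_upwards [hmul (a • k.1), hmul k.1, AEEqFun.coeFn_smul a k.1,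
          AEEqFun.coeFn_smul a (M * k.1)] with x h1 h2 h4 h5
        rw [h1, h5, Pi.smul_apply, h2, h4, Pi.smul_apply, smul_eq_mul, smul_eq_mul]
        ring }
  have hL : ∀ k ∈ convexHull ℝ (quasiBall μ), L k ∈ convexHull ℝ (quasiBall μ) := by
    have h1 : L '' convexHull ℝ (quasiBall μ) ⊆ convexHull ℝ (quasiBall μ) := by
      rw [LinearMap.image_convexHull]
      refine convexHull_mono ?_
      rintro _ ⟨y, hy, rfl⟩
      exact (hq y.1).trans hy
    exact fun k hk => h1 ⟨k, hk, rfl⟩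
  have hLg : L g = f := by
    refine Subtype.ext (AEEqFun.ext ?_)
    filter_upwards [hmul g.1, h] with x h1 h2
    change (M * g.1 : Ω →ₘ[μ] ℝ) x = f.1 x
    rw [h1]
    rcases eq_or_ne (g.1 x) 0 with h0 | h0
    · rw [h0, abs_zero] at h2
      rw [h0, mul_zero, abs_nonpos_iff.1 h2]
    · have h3 : |f.1 x / g.1 x| ≤ 1 := by
        rw [abs_div]; exact div_le_one_of_le₀ h2 (abs_nonneg _)
      have h4 : m x = f.1 x / g.1 x := by
        simp only [m]
        rw [min_eq_right (abs_le.1 h3).2, max_eq_right (abs_le.1 h3).1]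
      rw [h4, div_mul_cancel₀ _ h0]
  rw [norm_eq_gauge, norm_eq_gauge, gauge_def, gauge_def]
  refine csInf_le_csInf ⟨0, fun r hr => hr.1.le⟩ ?_ ?_
  · exact (absorbent_hull (μ := μ)).gauge_set_nonempty
  · rintro r ⟨hr, k, hk, hkg⟩
    refine ⟨hr, L k, hL k hk, ?_⟩
    change r • L k = f
    rw [← map_smul, ← hLg]
    exact congrArg L hkg

theorem coe_sub_ae (f g : WeakL1 μ) : ⇑(f - g).1 =ᵐ[μ] fun x => f.1 x - g.1 x :=
  AEEqFun.coeFn_sub f.1 g.1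

theorem norm_le_of_ae_abs_le_add {f g h : WeakL1 μ}
    (H : ∀ᵐ x ∂μ, |h.1 x| ≤ |f.1 x| + |g.1 x|) : ‖h‖ ≤ ‖f‖ + ‖g‖ := by
  let f' : WeakL1 μ := f ⊔ -f
  let g' : WeakL1 μ := g ⊔ -g
  have key (k : WeakL1 μ) : ⇑(k ⊔ -k).1 =ᵐ[μ] fun x => |k.1 x| := by
    filter_upwards [AEEqFun.coeFn_sup k.1 (-k).1, AEEqFun.coeFn_neg k.1] with x h1 h2
    change (k.1 ⊔ (-k).1 : Ω →ₘ[μ] ℝ) x = _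
    rw [h1]
    change k.1 x ⊔ (-k.1 : Ω →ₘ[μ] ℝ) x = _
    rw [h2]; rfl
  have h1 : ‖h‖ ≤ ‖f' + g'‖ := by
    refine norm_mono_of_ae ?_
    filter_upwards [H, key f, key g, AEEqFun.coeFn_add f'.1 g'.1] with x h1 h2 h3 h4
    have h5 : (f' + g').1 x = f'.1 x + g'.1 x := h4
    rw [h5, h2, h3]
    exact h1.trans (le_abs_self _)
  have h2 : ‖f'‖ ≤ ‖f‖ := norm_mono_of_ae <| by
    filter_upwards [key f] with x hx
    rw [hx, abs_abs]
  have h3 : ‖g'‖ ≤ ‖g‖ := norm_mono_of_ae <| by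
    filter_upwards [key g] with x hx
    rw [hx, abs_abs]
  linarith [norm_add_le f' g']

theorem norm_sup_sub_sup (f g f' g' : WeakL1 μ) :
    ‖f ⊔ g - f' ⊔ g'‖ ≤ ‖f - f'‖ + ‖g - g'‖ := by
  refine norm_le_of_ae_abs_le_add ?_
  filter_upwards [coe_sub_ae (f ⊔ g) (f' ⊔ g'), coe_sub_ae f f', coe_sub_ae g g',
    AEEqFun.coeFn_sup f.1 g.1, AEEqFun.coeFn_sup f'.1 g'.1] with x h1 h2 h3 h4 h5
  have h4' : (f ⊔ g).1 x = f.1 x ⊔ g.1 x := h4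
  have h5' : (f' ⊔ g').1 x = f'.1 x ⊔ g'.1 x := h5
  rw [h1, h2, h3, h4', h5']
  exact (abs_max_sub_max_le_max _ _ _ _).trans
    (max_le (by linarith [abs_nonneg (g.1 x - g'.1 x)]) (by linarith [abs_nonneg (f.1 x - f'.1 x)]))

theorem norm_inf_sub_inf (f g f' g' : WeakL1 μ) :
    ‖f ⊓ g - f' ⊓ g'‖ ≤ ‖f - f'‖ + ‖g - g'‖ := by
  refine norm_le_of_ae_abs_le_add ?_
  filter_upwards [coe_sub_ae (f ⊓ g) (f' ⊓ g'), coe_sub_ae f f', coe_sub_ae g g',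
    AEEqFun.coeFn_inf f.1 g.1, AEEqFun.coeFn_inf f'.1 g'.1] with x h1 h2 h3 h4 h5
  have h4' : (f ⊓ g).1 x = f.1 x ⊓ g.1 x := h4
  have h5' : (f' ⊓ g').1 x = f'.1 x ⊓ g'.1 x := h5
  rw [h1, h2, h3, h4', h5']
  exact (abs_min_sub_min_le_max _ _ _ _).trans
    (max_le (by linarith [abs_nonneg (g.1 x - g'.1 x)]) (by linarith [abs_nonneg (f.1 x - f'.1 x)]))

end WeakL1

variable (μ) in
/-- The normed envelope of Weak `L¹(μ)`: its quotient by the null space `N` of `ρ`, normed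
by `ρ`. -/
abbrev NormedEnvelope : Type _ := SeparationQuotient (WeakL1 μ)

namespace NormedEnvelope

theorem inseparable_iff {f g : WeakL1 μ} : Inseparable f g ↔ WeakL1.rho μ (f - g) = 0 := by
  rw [Metric.inseparable_iff, dist_eq_norm]; rfl

theorem inseparable_of_norm_le {f g f' g' h h' : WeakL1 μ} (h1 : Inseparable f f')
    (h2 : Inseparable g g') (H : ‖h - h'‖ ≤ ‖f - f'‖ + ‖g - g'‖) : Inseparable h h' := by
  rw [Metric.inseparable_iff, dist_eq_norm] at *
  rw [h1, h2] at H
  exact le_antisymm (by linarith) (norm_nonneg _)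

/-- Suprema of classes, computed on representatives. -/
def sup : NormedEnvelope μ → NormedEnvelope μ → NormedEnvelope μ :=
  Quotient.map₂ (· ⊔ ·) fun _ _ h1 _ _ h2 =>
    inseparable_of_norm_le h1 h2 (WeakL1.norm_sup_sub_sup _ _ _ _)

/-- Infima of classes, computed on representatives. -/
def inf : NormedEnvelope μ → NormedEnvelope μ → NormedEnvelope μ :=
  Quotient.map₂ (· ⊓ ·) fun _ _ h1 _ _ h2 =>
    inseparable_of_norm_le h1 h2 (WeakL1.norm_inf_sub_inf _ _ _ _)

/-- The quotient lattice structure: suprema and infima are computed on representatives, and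
`x ≤ y` means `x ⊔ y = y`. -/
instance : Lattice (NormedEnvelope μ) :=
  @Lattice.mk' _ ⟨sup⟩ ⟨inf⟩
    (by
      rintro ⟨a⟩ ⟨b⟩
      exact congrArg SeparationQuotient.mk (sup_comm a b))
    (by
      rintro ⟨a⟩ ⟨b⟩ ⟨c⟩
      exact congrArg SeparationQuotient.mk (sup_assoc a b c))
    (by
      rintro ⟨a⟩ ⟨b⟩
      exact congrArg SeparationQuotient.mk (inf_comm a b))
    (by
      rintro ⟨a⟩ ⟨b⟩ ⟨c⟩
      exact congrArg SeparationQuotient.mk (inf_assoc a b c))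
    (by
      rintro ⟨a⟩ ⟨b⟩
      exact congrArg SeparationQuotient.mk (sup_inf_self (a := a) (b := b)))
    (by
      rintro ⟨a⟩ ⟨b⟩
      exact congrArg SeparationQuotient.mk (inf_sup_self (a := a) (b := b)))

theorem mk_sup (f g : WeakL1 μ) :
    (SeparationQuotient.mk (f ⊔ g) : NormedEnvelope μ) =
      SeparationQuotient.mk f ⊔ SeparationQuotient.mk g := rfl

theorem mk_inf (f g : WeakL1 μ) :
    (SeparationQuotient.mk (f ⊓ g) : NormedEnvelope μ) =
      SeparationQuotient.mk f ⊓ SeparationQuotient.mk g := rfl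

theorem le_iff {x y : NormedEnvelope μ} :
    x ≤ y ↔ ∃ f g : WeakL1 μ,
      SeparationQuotient.mk f = x ∧ SeparationQuotient.mk g = y ∧ f ≤ g := by
  constructor
  · intro h
    obtain ⟨f, rfl⟩ := SeparationQuotient.surjective_mk x
    obtain ⟨g, rfl⟩ := SeparationQuotient.surjective_mk y
    exact ⟨f, f ⊔ g, rfl, by rw [mk_sup]; exact sup_eq_right.2 h, le_sup_left⟩
  · rintro ⟨f, g, rfl, rfl, h⟩
    rw [← sup_eq_right, ← mk_sup, sup_eq_right.2 h]

end NormedEnvelope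

/-- The normed envelope of Weak `L¹[0,1]`. -/
abbrev W : Type := NormedEnvelope (volume : Measure I)

end WeakL1

/-! ## Köthe function spaces -/

section Kothe

variable {Ω : Type*} [MeasurableSpace Ω]

/-- The class of the characteristic function of a measurable set. -/
def charFn (μ : Measure Ω) (A : Set Ω) (hA : MeasurableSet A) : Ω →ₘ[μ] ℝ :=
  AEEqFun.mk (A.indicator fun _ => (1 : ℝ))
    (stronglyMeasurable_const.indicator hA).aestronglyMeasurable

/-- The simple integrable functions. -/
def simpleIntegrable (μ : Measure Ω) : Submodule ℝ (Ω →ₘ[μ] ℝ) :=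
  Submodule.span ℝ {s | ∃ (A : Set Ω) (hA : MeasurableSet A), μ A < ∞ ∧ s = charFn μ A hA}

/-- A Köthe function space over `μ`: a Banach space of classes of locally integrable functions
which is solid and contains the characteristic functions of all sets of finite measure.
Only the values of `nrm` on `carrier` matter. -/
structure KotheSpace (μ : Measure Ω) where
  carrier : Submodule ℝ (Ω →ₘ[μ] ℝ)
  nrm : (Ω →ₘ[μ] ℝ) → ℝ
  nrm_nonneg : ∀ f ∈ carrier, 0 ≤ nrm f
  nrm_eq_zero : ∀ f ∈ carrier, nrm f = 0 ↔ f = 0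
  nrm_smul : ∀ (a : ℝ), ∀ f ∈ carrier, nrm (a • f) = |a| * nrm f
  nrm_add_le : ∀ f ∈ carrier, ∀ g ∈ carrier, nrm (f + g) ≤ nrm f + nrm g
  complete : ∀ u : ℕ → Ω →ₘ[μ] ℝ, (∀ n, u n ∈ carrier) →
    (∀ ε > 0, ∃ n₀, ∀ m ≥ n₀, ∀ n ≥ n₀, nrm (u m - u n) < ε) →
    ∃ f ∈ carrier, ∀ ε > 0, ∃ n₀, ∀ n ≥ n₀, nrm (u n - f) < ε
  locallyIntegrable : ∀ f ∈ carrier, ∀ A, MeasurableSet A → μ A < ∞ → IntegrableOn f A μ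
  solid : ∀ f g : Ω →ₘ[μ] ℝ, |f| ≤ |g| → g ∈ carrier → f ∈ carrier ∧ nrm f ≤ nrm g
  charFn_mem : ∀ A (hA : MeasurableSet A), μ A < ∞ → charFn μ A hA ∈ carrier

namespace KotheSpace

variable {μ : Measure Ω} (X : KotheSpace μ)

/-- The space `X` as a type. -/
def Elem : Type _ := ↥X.carrier

instance : AddCommGroup X.Elem := inferInstanceAs (AddCommGroup ↥X.carrier)
instance : Module ℝ X.Elem := inferInstanceAs (Module ℝ ↥X.carrier)

instance : Norm X.Elem := ⟨fun f => X.nrm f.1⟩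

theorem normedSpaceCore : NormedSpace.Core ℝ X.Elem where
  norm_nonneg f := X.nrm_nonneg f.1 f.2
  norm_smul a f := X.nrm_smul a f.1 f.2
  norm_triangle f g := X.nrm_add_le f.1 f.2 g.1 g.2
  norm_eq_zero_iff f := (X.nrm_eq_zero f.1 f.2).trans
    ⟨fun h => Subtype.ext h, fun h => congrArg Subtype.val h⟩

instance : NormedAddCommGroup X.Elem := NormedAddCommGroup.ofCore X.normedSpaceCore
instance : NormedSpace ℝ X.Elem := NormedSpace.ofCore X.normedSpaceCore

theorem abs_mem {f : Ω →ₘ[μ] ℝ} (hf : f ∈ X.carrier) : |f| ∈ X.carrier := by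
  refine (X.solid _ f (AEEqFun.coeFn_le.1 ?_) hf).1
  filter_upwards [AEEqFun.coeFn_abs |f|, AEEqFun.coeFn_abs f] with x h1 h2
  rw [h1, h2, abs_abs]

theorem mem_of_ae_le {f g h : Ω →ₘ[μ] ℝ} (hf : f ∈ X.carrier) (hg : g ∈ X.carrier)
    (H : ∀ᵐ x ∂μ, |h x| ≤ |f x| + |g x|) : h ∈ X.carrier := by
  refine (X.solid h (|f| + |g|) (AEEqFun.coeFn_le.1 ?_)
    (X.carrier.add_mem (X.abs_mem hf) (X.abs_mem hg))).1
  filter_upwards [H, AEEqFun.coeFn_abs h, AEEqFun.coeFn_abs (|f| + |g|),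
    AEEqFun.coeFn_add |f| |g|, AEEqFun.coeFn_abs f, AEEqFun.coeFn_abs g] with x h0 h1 h2 h3 h4 h5
  rw [h1, h2, h3, Pi.add_apply, h4, h5]
  exact h0.trans (le_abs_self _)

theorem sup_mem {f g : Ω →ₘ[μ] ℝ} (hf : f ∈ X.carrier) (hg : g ∈ X.carrier) :
    f ⊔ g ∈ X.carrier := by
  refine X.mem_of_ae_le hf hg ?_
  filter_upwards [AEEqFun.coeFn_sup f g] with x hx
  rw [hx]
  rcases max_choice (f x) (g x) with h | h <;> rw [h] <;> linarith [abs_nonneg (f x), abs_nonneg (g x)]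

theorem inf_mem {f g : Ω →ₘ[μ] ℝ} (hf : f ∈ X.carrier) (hg : g ∈ X.carrier) :
    f ⊓ g ∈ X.carrier := by
  refine X.mem_of_ae_le hf hg ?_
  filter_upwards [AEEqFun.coeFn_inf f g] with x hx
  rw [hx]
  rcases min_choice (f x) (g x) with h | h <;> rw [h] <;> linarith [abs_nonneg (f x), abs_nonneg (g x)]

/-- The almost everywhere pointwise lattice operations. -/
instance : Lattice X.Elem :=
  Subtype.lattice (P := fun f => f ∈ X.carrier) (fun _ _ => X.sup_mem) (fun _ _ => X.inf_mem)

/-- The Köthe dual `X'`: all measurable `g` for which `f ↦ ∫ f g` is defined on `X`. -/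
def dual : Set (Ω →ₘ[μ] ℝ) :=
  {g | ∀ f ∈ X.carrier, Integrable (fun x => f x * g x) μ}

/-- The closed unit ball of `X'`, for the norm of `X'` as a subspace of the Banach dual `X*`. -/
def dualBall : Set (Ω →ₘ[μ] ℝ) :=
  {g | g ∈ X.dual ∧ ∀ f ∈ X.carrier, |∫ x, f x * g x ∂μ| ≤ X.nrm f}

/-- The second Köthe dual `X''`. -/
def bidual : Set (Ω →ₘ[μ] ℝ) :=
  {h | ∀ g ∈ X.dual, Integrable (fun x => h x * g x) μ}

/-- `X'` is a norming subspace of `X*`: `‖f‖` is the supremum of `|∫ f g|` over the unit ball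
of `X'`. -/
def DualNorming : Prop :=
  ∀ f ∈ X.carrier, IsLUB ((fun g : Ω →ₘ[μ] ℝ => |∫ x, f x * g x ∂μ|) '' X.dualBall) (X.nrm f)

/-- `X = X''`. -/
def IsMaximal : Prop := (X.carrier : Set (Ω →ₘ[μ] ℝ)) = X.bidual

/-- `X` is the closed linear span in `X''` of the simple integrable functions. The norm of
`h ∈ X''` is the supremum of `|∫ h g|` over the unit ball of `X'`. -/
def IsMinimal : Prop :=
  (X.carrier : Set (Ω →ₘ[μ] ℝ)) =
    {h | h ∈ X.bidual ∧ ∀ ε > 0, ∃ s ∈ simpleIntegrable μ,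
      ∀ g ∈ X.dualBall, |∫ x, (h - s) x * g x ∂μ| ≤ ε}

/-- Invariance under every automorphism of the measure space. -/
def AutomorphismInvariant : Prop :=
  ∀ (τ : Ω ≃ᵐ Ω) (hτ : MeasurePreserving τ μ μ) (f : Ω →ₘ[μ] ℝ),
    (f ∈ X.carrier ↔ f.compMeasurePreserving τ hτ ∈ X.carrier) ∧
    (f ∈ X.carrier → X.nrm (f.compMeasurePreserving τ hτ) = X.nrm f)

/-- The conditions common to rearrangement invariant spaces on all three measure spaces. -/
structure IsRIBase : Prop where
  invariant : X.AutomorphismInvariant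
  norming : X.DualNorming
  maximal_or_minimal : X.IsMaximal ∨ X.IsMinimal

end KotheSpace

/-- Rearrangement invariant spaces on `ℕ`: in addition `ℓ¹ ⊆ X ⊆ ℓ^∞` with inclusions of norm
at most one. -/
structure IsRINat (X : KotheSpace (Measure.count : Measure ℕ)) : Prop extends X.IsRIBase where
  l1_le : ∀ f : ℕ →ₘ[Measure.count] ℝ, eLpNorm f 1 Measure.count < ∞ →
    f ∈ X.carrier ∧ ENNReal.ofReal (X.nrm f) ≤ eLpNorm f 1 Measure.count
  le_linfty : ∀ f ∈ X.carrier, eLpNorm f ∞ Measure.count ≤ ENNReal.ofReal (X.nrm f)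

/-- Rearrangement invariant spaces on `[0,1]`: in addition `L^∞ ⊆ X ⊆ L¹` with inclusions of
norm at most one. -/
structure IsRIUnit (X : KotheSpace (volume : Measure I)) : Prop extends X.IsRIBase where
  linfty_le : ∀ f : I →ₘ[volume] ℝ, eLpNorm f ∞ volume < ∞ →
    f ∈ X.carrier ∧ ENNReal.ofReal (X.nrm f) ≤ eLpNorm f ∞ volume
  le_l1 : ∀ f ∈ X.carrier, eLpNorm f 1 volume ≤ ENNReal.ofReal (X.nrm f)

/-- Lebesgue measure on `[0,∞)`. -/
def halfLine : Measure (Ici (0 : ℝ)) := Measure.comap Subtype.val volume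

/-- The norm of `L¹ + L^∞`. -/
def sumNorm (μ : Measure Ω) (f : Ω →ₘ[μ] ℝ) : ℝ≥0∞ :=
  ⨅ (g : Ω →ₘ[μ] ℝ) (h : Ω →ₘ[μ] ℝ) (_ : f = g + h), eLpNorm g 1 μ + eLpNorm h ∞ μ

/-- Rearrangement invariant spaces on `[0,∞)`: in addition `L¹ ∩ L^∞ ⊆ X ⊆ L¹ + L^∞` with
inclusions of norm at most one. -/
structure IsRIHalfLine (X : KotheSpace halfLine) : Prop extends X.IsRIBase where
  inter_le : ∀ f : Ici (0 : ℝ) →ₘ[halfLine] ℝ,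
    eLpNorm f 1 halfLine < ∞ → eLpNorm f ∞ halfLine < ∞ →
    f ∈ X.carrier ∧
      ENNReal.ofReal (X.nrm f) ≤ max (eLpNorm f 1 halfLine) (eLpNorm f ∞ halfLine)
  le_sum : ∀ f ∈ X.carrier, sumNorm halfLine f ≤ ENNReal.ofReal (X.nrm f)

end Kothe

/-- `E` is isometrically lattice isomorphic to a (vector) sublattice of `F`. -/
def IsometricSublattice (E F : Type*) [NormedAddCommGroup E] [NormedSpace ℝ E] [Lattice E]
    [NormedAddCommGroup F] [NormedSpace ℝ F] [Lattice F] : Prop :=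
  ∃ S : Submodule ℝ F, (∀ x ∈ S, ∀ y ∈ S, x ⊔ y ∈ S ∧ x ⊓ y ∈ S) ∧
    ∃ T : E ≃ₗᵢ[ℝ] S, ∀ x y : E,
      ((T (x ⊔ y) : S) : F) = (T x : F) ⊔ (T y : F) ∧
      ((T (x ⊓ y) : S) : F) = (T x : F) ⊓ (T y : F)

end

/-!
The embedding exists for every Köthe space `X` with norming Köthe dual over a nonzero σ-finite
measure on a standard Borel space; the three classical measure spaces are of this kind.

*Countably many weights.* The integrable functions in the unit ball of `X'` form a separable subset
of `L¹`. By Fatou's lemma a dense sequence in it has the same supremum of integrals against `|f|` as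
the whole ball, so `‖f‖ = sup_n ∫ |f| v_n dP` for suitable weights `v_n ≥ 0` and a probability
measure `P` (`KotheSpace.exists_probability_norming`). Thus `X` sits inside an `ℓ^∞`-sum of
`L¹`-spaces, compatibly with the order.

*One `L¹`-space.* If `s` is uniform on `(0,1)` and independent of `x`, then `u(x) / s` has
`c λ{|u / s| > c} ≤ ‖u‖₁` for all `c`, while its integral over the set where its values lie in
`(a, b)` is about `‖u‖₁ log (b / a)`. Since `ρ(f) ≤ limsup_{c → ∞} c λ{|f| > c}`
(`WeakL1.norm_le_of_eventually`) and conversely the integral of `|f|` over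
`{a < |f| < b}` is at most `ρ(f) log (b / a) + O(1)` (`WeakL1.exists_setLIntegral_window_le`),
the envelope norm of `u / s` is exactly `‖u‖₁`.

*All weights at once.* `[0,1]` is split into blocks whose probabilities `π{k}` decrease very
rapidly. On the `k`-th block `f` is represented by `f v_{n(k)} / (π{k} s)`, where `n(k)` takes each
value infinitely often, truncated at a level that makes later blocks negligible. Without truncation
the values of one block would interfere with those of the others, since the tails of `f v_n` need
not be small uniformly in `n`. The truncation is not linear, but its cut-off factor is a slowly
varying function of the logarithm of the value, with slope `1 / (k + 1)` on the `k`-th block. It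
therefore commutes with sums, scalar multiples, suprema and infima up to errors of order
`1 / (k + 1)` relative to the arguments (`slowTrunc.abs_add_sub_le`), and such errors vanish in the
envelope (`KotheSpace.NormingBlocks.norm_eq_zero_of_abs_le`).
-/

open scoped NNReal Topology

/-! ### Slowly varying truncation -/

/-- The truncation `v ↦ v θ(log |v|)`, where `θ` is `1` below `β - η⁻¹`, is `0` above `β` and is
affine of slope `-η` in between. As `θ` varies slowly, truncation is linear up to an error that is
`η` times the size of the arguments. -/
noncomputable def slowTrunc (η β v : ℝ) : ℝ :=
  v * max 0 (min 1 (η * (β - Real.log |v|)))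

namespace slowTrunc

variable {η β : ℝ}

theorem neg (v : ℝ) : slowTrunc η β (-v) = -slowTrunc η β v := by
  simp [slowTrunc]

@[simp] theorem zero : slowTrunc η β 0 = 0 := by simp [slowTrunc]

theorem nonneg {v : ℝ} (hv : 0 ≤ v) : 0 ≤ slowTrunc η β v :=
  mul_nonneg hv (le_max_left _ _)

theorem abs_le_abs (v : ℝ) : |slowTrunc η β v| ≤ |v| := by
  rw [slowTrunc, abs_mul, abs_of_nonneg (le_max_left (0 : ℝ) _)]
  exact mul_le_of_le_one_right (abs_nonneg v) (max_le zero_le_one (min_le_left _ _))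

theorem abs_le_exp (hη : 0 ≤ η) (v : ℝ) : |slowTrunc η β v| ≤ Real.exp β := by
  rcases le_or_gt |v| (Real.exp β) with h | h
  · exact (abs_le_abs v).trans h
  · have h1 : β < Real.log |v| := (Real.lt_log_iff_exp_lt ((Real.exp_pos _).trans h)).2 h
    have h2 : η * (β - Real.log |v|) ≤ 0 := mul_nonpos_of_nonneg_of_nonpos hη (by linarith)
    rw [slowTrunc, max_eq_left ((min_le_right _ _).trans h2), mul_zero, abs_zero]
    positivity

theorem eq_self (hη : 0 < η) {v : ℝ} (hv : |v| ≤ Real.exp (β - η⁻¹)) : slowTrunc η β v = v := by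
  rcases eq_or_ne v 0 with rfl | h0
  · simp
  have h1 : Real.log |v| ≤ β - η⁻¹ := (Real.log_le_iff_le_exp (abs_pos.2 h0)).2 hv
  have h2 : 1 ≤ η * (β - Real.log |v|) := by
    calc 1 = η * η⁻¹ := (mul_inv_cancel₀ hη.ne').symm
      _ ≤ _ := by gcongr; linarith
  rw [slowTrunc, min_eq_left h2, max_eq_right zero_le_one, mul_one]

/-- The cut-off factor is `η`-Lipschitz in the logarithm. -/
theorem abs_cutoff_sub_le (hη : 0 ≤ η) (s t : ℝ) :
    |max 0 (min 1 (η * (β - s))) - max 0 (min 1 (η * (β - t)))| ≤ η * |s - t| := by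
  calc _ ≤ |min 1 (η * (β - s)) - min 1 (η * (β - t))| := by
        simpa using abs_max_sub_max_le_max 0 (min 1 (η * (β - s))) 0 (min 1 (η * (β - t)))
    _ ≤ |η * (β - s) - η * (β - t)| := by
        simpa using abs_min_sub_min_le_max 1 (η * (β - s)) 1 (η * (β - t))
    _ = η * |s - t| := by
        rw [← mul_sub, abs_mul, abs_of_nonneg hη, sub_sub_sub_cancel_left, abs_sub_comm]

theorem abs_mul_sub_le (hη : 0 ≤ η) {a : ℝ} (ha : a ≠ 0) (v : ℝ) :
    |slowTrunc η β (a * v) - a * slowTrunc η β v| ≤ η * (|a| * |(Real.log |a|)| * |v|) := by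
  rcases eq_or_ne v 0 with rfl | hv
  · simp
  rw [slowTrunc, slowTrunc, mul_assoc a, ← mul_assoc a, ← mul_assoc a, ← mul_sub, abs_mul, abs_mul,
    Real.log_mul (abs_ne_zero.2 ha) (abs_ne_zero.2 hv)]
  calc |a| * |v| * _ ≤ |a| * |v| * (η * |(Real.log |a| + Real.log |v| - Real.log |v|)|) := by
        gcongr; exact abs_cutoff_sub_le hη _ _
    _ = _ := by rw [add_sub_cancel_right]; ring

theorem abs_add_sub_le_of_nonneg (hη : 0 ≤ η) {v w : ℝ} (hv : 0 ≤ v) (hw : 0 ≤ w) :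
    |slowTrunc η β (v + w) - slowTrunc η β v - slowTrunc η β w| ≤ η * (v + w) := by
  have key (x y : ℝ) (hx : 0 < x) (hy : 0 ≤ y) :
      |x * max 0 (min 1 (η * (β - Real.log |x + y|))) - slowTrunc η β x| ≤ η * y := by
    rw [slowTrunc, ← mul_sub, abs_mul, abs_of_pos hx, abs_of_pos (by linarith : 0 < x + y)]
    calc x * _ ≤ x * (η * |Real.log (x + y) - Real.log x|) := by
          gcongr; exact abs_cutoff_sub_le hη _ _
      _ = x * (η * Real.log ((x + y) / x)) := by
          rw [Real.log_div (by linarith) hx.ne', abs_of_nonneg]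
          exact sub_nonneg.2 (Real.log_le_log hx (by linarith))
      _ ≤ x * (η * ((x + y) / x - 1)) := by
          gcongr; exact Real.log_le_sub_one_of_pos (by positivity)
      _ = η * y := by field_simp; ring
  rcases hv.eq_or_lt with rfl | hv
  · simpa using mul_nonneg hη hw
  rcases hw.eq_or_lt with rfl | hw
  · simpa using mul_nonneg hη hv.le
  have h1 := key v w hv hw.le
  have h2 := key w v hw hv.le
  rw [add_comm w v] at h2
  have h3 : slowTrunc η β (v + w) - slowTrunc η β v - slowTrunc η β w
      = (v * max 0 (min 1 (η * (β - Real.log |v + w|))) - slowTrunc η β v)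
        + (w * max 0 (min 1 (η * (β - Real.log |v + w|))) - slowTrunc η β w) := by
    rw [slowTrunc]; ring
  rw [h3]
  exact (abs_add_le _ _).trans (by linarith)

theorem abs_add_sub_le (hη : 0 ≤ η) (v w : ℝ) :
    |slowTrunc η β (v + w) - slowTrunc η β v - slowTrunc η β w| ≤ η * (|v| + |w|) := by
  -- Oddness reduces every sign pattern to the additivity of truncation on two nonnegative numbers.
  have mixed (x y : ℝ) (hy : 0 ≤ y) (hxy : y ≤ x) :
      |slowTrunc η β (x + -y) - slowTrunc η β x - slowTrunc η β (-y)| ≤ η * (|x| + |-y|) := by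
    have h := abs_add_sub_le_of_nonneg (β := β) hη (sub_nonneg.2 hxy) hy
    rw [sub_add_cancel] at h
    rw [neg, ← sub_eq_add_neg, abs_neg, abs_of_nonneg hy, abs_of_nonneg (hy.trans hxy)]
    calc _ ≤ η * (x - y + y) := by
          rw [sub_add_cancel, ← abs_neg]
          convert h using 2
          ring
      _ ≤ _ := by gcongr; linarith
  have flip (x y : ℝ)
      (h : |slowTrunc η β (-x + -y) - slowTrunc η β (-x) - slowTrunc η β (-y)| ≤
        η * (|-x| + |-y|)) :
      |slowTrunc η β (x + y) - slowTrunc η β x - slowTrunc η β y| ≤ η * (|x| + |y|) := by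
    rw [← neg_add, neg, neg, neg, abs_neg, abs_neg] at h
    rw [← abs_neg]
    convert h using 2
    ring
  have swap (x y : ℝ)
      (h : |slowTrunc η β (y + x) - slowTrunc η β y - slowTrunc η β x| ≤ η * (|y| + |x|)) :
      |slowTrunc η β (x + y) - slowTrunc η β x - slowTrunc η β y| ≤ η * (|x| + |y|) := by
    rw [add_comm x y, sub_right_comm, add_comm |x|]; exact h
  have opp (x y : ℝ) (hx : 0 ≤ x) (hy : 0 ≤ y) :
      |slowTrunc η β (x + -y) - slowTrunc η β x - slowTrunc η β (-y)| ≤ η * (|x| + |-y|) := by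
    rcases le_total y x with h | h
    · exact mixed x y hy h
    · refine flip _ _ (swap _ _ ?_)
      rw [neg_neg]
      exact mixed y x hx h
  rcases le_total 0 v with hv | hv <;> rcases le_total 0 w with hw | hw
  · rw [abs_of_nonneg hv, abs_of_nonneg hw]; exact abs_add_sub_le_of_nonneg hη hv hw
  · simpa using opp v (-w) hv (by linarith)
  · refine swap _ _ ?_
    simpa using opp w (-v) hw (by linarith)
  · refine flip _ _ ?_
    rw [abs_neg, abs_neg, abs_of_nonpos hv, abs_of_nonpos hw]
    exact abs_add_sub_le_of_nonneg hη (by linarith) (by linarith)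

theorem le_add_of_le (hη : 0 ≤ η) {v w : ℝ} (h : w ≤ v) :
    slowTrunc η β w ≤ slowTrunc η β v + η * (|v| + |w|) := by
  have h1 := abs_add_sub_le (β := β) hη v (-w)
  rw [neg, abs_neg] at h1
  have h2 : 0 ≤ slowTrunc η β (v + -w) := nonneg (by linarith)
  linarith [(abs_le.1 h1).2]

theorem abs_max_sub_le (hη : 0 ≤ η) (v w : ℝ) :
    |slowTrunc η β (max v w) - max (slowTrunc η β v) (slowTrunc η β w)| ≤ η * (|v| + |w|) := by
  have h0 : 0 ≤ η * (|v| + |w|) := by positivity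
  rw [abs_sub_comm, abs_le]
  rcases le_total w v with h | h
  · rw [max_eq_left h]
    exact ⟨by linarith [le_max_left (slowTrunc η β v) (slowTrunc η β w)],
      sub_le_iff_le_add'.2 (max_le (by linarith) (le_add_of_le hη h))⟩
  · rw [max_eq_right h]
    refine ⟨by linarith [le_max_right (slowTrunc η β v) (slowTrunc η β w)],
      sub_le_iff_le_add'.2 (max_le ?_ (by linarith))⟩
    rw [add_comm |v|]; exact le_add_of_le hη h

theorem abs_min_sub_le (hη : 0 ≤ η) (v w : ℝ) :
    |slowTrunc η β (min v w) - min (slowTrunc η β v) (slowTrunc η β w)| ≤ η * (|v| + |w|) := by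
  have h := abs_max_sub_le (β := β) hη (-v) (-w)
  rw [max_neg_neg, neg, neg, neg, max_neg_neg, abs_neg, abs_neg] at h
  rw [← abs_neg]
  convert h using 2
  ring

theorem measurable (η β : ℝ) : Measurable (slowTrunc η β) := by
  unfold slowTrunc
  fun_prop

end slowTrunc

/-! ### Upper estimates for the envelope norm -/

namespace WeakL1

section General

variable {Ω : Type*} [MeasurableSpace Ω] {μ : Measure Ω}

theorem weakQuasiNorm_le_iff {f : Ω →ₘ[μ] ℝ} {g : Ω → ℝ} (h : f =ᵐ[μ] g) {r : ℝ≥0∞} :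
    weakQuasiNorm μ f ≤ r ↔ ∀ c : ℝ, 0 < c → ENNReal.ofReal c * μ {x | c < |g x|} ≤ r := by
  have (c : ℝ) : μ {x | c < |f x|} = μ {x | c < |g x|} := by
    refine measure_congr ?_
    filter_upwards [h] with x hx
    exact congrArg (fun t => c < |t|) hx
  simp only [weakQuasiNorm, iSup_le_iff, this]

theorem norm_le_one_of_mem_quasiBall {f : WeakL1 μ} (hf : f ∈ quasiBall μ) : ‖f‖ ≤ 1 := by
  rw [norm_eq_gauge]
  exact gauge_le_one_of_mem (subset_convexHull ℝ _ hf)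

theorem norm_le_of_weakQuasiNorm_le {f : WeakL1 μ} {r : ℝ} (hr : 0 < r)
    (hf : weakQuasiNorm μ f.1 ≤ ENNReal.ofReal r) : ‖f‖ ≤ r := by
  have h1 : r⁻¹ • f ∈ quasiBall μ := by
    refine (weakQuasiNorm_smul r⁻¹ f.1).trans ?_
    calc _ ≤ ENNReal.ofReal |r⁻¹| * ENNReal.ofReal r := by gcongr
      _ = 1 := by
        rw [← ENNReal.ofReal_mul (abs_nonneg _), abs_of_pos (inv_pos.2 hr), inv_mul_cancel₀ hr.ne',
          ENNReal.ofReal_one]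
  have h2 := norm_le_one_of_mem_quasiBall h1
  rw [norm_smul, Real.norm_of_nonneg (inv_pos.2 hr).le] at h2
  rwa [inv_mul_le_iff₀ hr, mul_one] at h2

/-- A measurable function with finite quasinorm represents an element of Weak `L¹`. -/
theorem exists_eq_of_forall_le (g : Ω → ℝ) (hg : AEStronglyMeasurable g μ) {r : ℝ≥0∞}
    (hr : r < ∞) (h : ∀ c : ℝ, 0 < c → ENNReal.ofReal c * μ {x | c < |g x|} ≤ r) :
    ∃ f : WeakL1 μ, f.1 =ᵐ[μ] g ∧ weakQuasiNorm μ f.1 ≤ r := by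
  have h1 := AEEqFun.coeFn_mk g hg
  exact ⟨⟨AEEqFun.mk g hg, ((weakQuasiNorm_le_iff h1).2 h).trans_lt hr⟩, h1,
    (weakQuasiNorm_le_iff h1).2 h⟩

theorem exists_eq_of_forall_abs_le [IsFiniteMeasure μ] (g : Ω → ℝ) (hg : AEStronglyMeasurable g μ)
    {C : ℝ} (h : ∀ x, |g x| ≤ C) : ∃ f : WeakL1 μ, f.1 =ᵐ[μ] g := by
  obtain ⟨f, hf, -⟩ := exists_eq_of_forall_le (r := ENNReal.ofReal C * μ univ) g hg
    (ENNReal.mul_lt_top (by simp) (measure_lt_top _ _)) fun c hc => by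
      by_cases hcC : c ≤ C
      · gcongr; exact subset_univ _
      · have : {x | c < |g x|} = ∅ := by
          ext x; simpa using (h x).trans (not_le.1 hcC).le
        simp [this]
  exact ⟨f, hf⟩

theorem coe_sum_ae {ι : Type*} (s : Finset ι) (f : ι → WeakL1 μ) (g : ι → Ω → ℝ)
    (h : ∀ i ∈ s, (f i).1 =ᵐ[μ] g i) : (∑ i ∈ s, f i).1 =ᵐ[μ] fun x => ∑ i ∈ s, g i x := by
  classical
  induction s using Finset.induction_on with
  | empty => exact AEEqFun.coeFn_zero
  | insert i s hi ih =>
    have h1 := ih fun j hj => h j (Finset.mem_insert_of_mem hj)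
    filter_upwards [h1, h i (Finset.mem_insert_self i s),
      AEEqFun.coeFn_add (f i).1 (∑ j ∈ s, f j).1] with x h1 h2 h3
    rw [Finset.sum_insert hi, Finset.sum_insert hi, ← h1, ← h2]
    exact h3

end General

/-- The `n + 1` cyclic translates of the function taking the value `(n + 1) / (i + 1)` on the
`i`-th of `n + 1` sets of equal measure lie in the ball of `q`, and their average is the constant
`1 + 1 / 2 + ⋯ + 1 / (n + 1)`. -/
theorem harmonic_mul_norm_le (e : WeakL1 (volume : Measure I)) (he : e.1 =ᵐ[volume] fun _ => 1)
    (n : ℕ) : (∑ i ∈ Finset.range (n + 1), 1 / ((i : ℝ) + 1)) * ‖e‖ ≤ 1 := by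
  obtain ⟨φ, hφ, hφm⟩ := Measure.exists_measurable_map_eq
    (ProbabilityTheory.uniformOn (univ : Set (Fin (n + 1))))
  have hn : (0 : ℝ) < (n : ℝ) + 1 := by positivity
  let a : Fin (n + 1) → ℝ := fun i => (n + 1) / ((i : ℕ) + 1)
  let b : Fin (n + 1) → I → ℝ := fun j x => a (φ x + j)
  have hb (j : Fin (n + 1)) : ∃ f : WeakL1 (volume : Measure I), f.1 =ᵐ[volume] b j ∧
      weakQuasiNorm volume f.1 ≤ 1 := by
    refine exists_eq_of_forall_le (b j) ?_ ENNReal.one_lt_top fun c hc => ?_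
    · exact ((measurable_of_finite fun i => a (i + j)).comp hφ).aestronglyMeasurable
    · have h1 : volume {x | c < |b j x|} =
          ProbabilityTheory.uniformOn univ {i : Fin (n + 1) | c < |a (i + j)|} := by
        rw [← hφm, Measure.map_apply hφ (MeasurableSet.of_discrete)]; rfl
      have h2 : Measure.count {i : Fin (n + 1) | c < |a (i + j)|} ≤
          ENNReal.ofReal ((n + 1) / c) := by
        have h3 : {i : Fin (n + 1) | c < |a (i + j)|} =
            (Equiv.addRight j).symm '' {i : Fin (n + 1) | c < a i} := by
          ext i
          rw [Equiv.image_symm_eq_preimage]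
          have : 0 < a (i + j) := by positivity
          simp [abs_of_pos this]
        rw [h3, Measure.count_injective_image (Equiv.injective _)]
        have h4 : {i : Fin (n + 1) | c < a i} =
            ((Finset.univ.filter fun i => c < a i : Finset (Fin (n + 1))) : Set (Fin (n + 1))) := by
          simp
        rw [h4, Measure.count_apply_finset]
        have h5 : (Finset.univ.filter fun i => c < a i : Finset (Fin (n + 1))).card ≤
            ⌊((n : ℝ) + 1) / c⌋₊ := by
          rw [← Finset.card_range ⌊((n : ℝ) + 1) / c⌋₊]
          refine Finset.card_le_card_of_injOn (fun i => (i : ℕ)) (fun i hi => ?_)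
            (fun i _ j _ h => Fin.ext h)
          have hi' : c < (n + 1) / (((i : ℕ) : ℝ) + 1) := by simpa using hi
          rw [lt_div_iff₀ (by positivity), mul_comm, ← lt_div_iff₀ hc] at hi'
          have : (i : ℕ) + 1 ≤ ⌊((n : ℝ) + 1) / c⌋₊ := Nat.le_floor (by push_cast; exact hi'.le)
          simpa using this
        rw [← ENNReal.ofReal_natCast]
        refine ENNReal.ofReal_le_ofReal ?_
        exact (Nat.cast_le.2 h5).trans (Nat.floor_le (by positivity))
      rw [h1, ProbabilityTheory.uniformOn_univ]
      have h6 : (Fintype.card (Fin (n + 1)) : ℝ≥0∞) = ENNReal.ofReal (n + 1) := by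
        rw [Fintype.card_fin, ← ENNReal.ofReal_natCast]; push_cast; rfl
      calc _ ≤ ENNReal.ofReal c * (ENNReal.ofReal ((n + 1) / c) / ENNReal.ofReal (n + 1)) := by
            rw [h6]; gcongr
        _ = 1 := by
          rw [← ENNReal.ofReal_div_of_pos hn, ← ENNReal.ofReal_mul hc.le, ← ENNReal.ofReal_one]
          congr 1; field_simp
  choose f hf hq using hb
  have hsum : ((∑ i ∈ Finset.range (n + 1), 1 / ((i : ℝ) + 1)) * (n + 1)) • e = ∑ j, f j := by
    refine Subtype.ext (AEEqFun.ext ?_)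
    filter_upwards [coe_sum_ae Finset.univ f b fun j _ => hf j, he,
      AEEqFun.coeFn_smul ((∑ i ∈ Finset.range (n + 1), 1 / ((i : ℝ) + 1)) * (n + 1)) e.1]
      with x h1 h2 h3
    rw [h1]
    refine Eq.trans h3 ?_
    rw [Pi.smul_apply, h2, smul_eq_mul, mul_one]
    have h4 : ∑ j, b j x = ∑ j, a j := Equiv.sum_comp (Equiv.addLeft (φ x)) a
    rw [h4, Finset.sum_range, Finset.sum_mul]
    refine Finset.sum_congr rfl fun i _ => ?_
    simp only [a]; ring
  have hle : ‖∑ j, f j‖ ≤ n + 1 := by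
    refine (norm_sum_le _ _).trans ((Finset.sum_le_card_nsmul _ _ 1 fun j _ =>
      norm_le_one_of_mem_quasiBall (hq j)).trans ?_)
    simp
  rw [← hsum, norm_smul, Real.norm_of_nonneg (by positivity)] at hle
  have h7 : ((∑ i ∈ Finset.range (n + 1), 1 / ((i : ℝ) + 1)) * ‖e‖) * (n + 1) ≤ 1 * (n + 1) := by
    linarith
  exact le_of_mul_le_mul_right h7 hn

theorem norm_one_eq_zero (e : WeakL1 (volume : Measure I)) (he : e.1 =ᵐ[volume] fun _ => 1) :
    ‖e‖ = 0 := by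
  by_contra h0
  have hpos : 0 < ‖e‖ := lt_of_le_of_ne (norm_nonneg _) (Ne.symm h0)
  obtain ⟨n, hn⟩ := ((Real.tendsto_sum_range_one_div_nat_succ_atTop.comp
    (Filter.tendsto_add_atTop_nat 1)).eventually_gt_atTop ‖e‖⁻¹).exists
  have h := harmonic_mul_norm_le e he n
  have h1 : ‖e‖⁻¹ * ‖e‖ < (∑ i ∈ Finset.range (n + 1), 1 / ((i : ℝ) + 1)) * ‖e‖ := by
    gcongr; exact hn
  rw [inv_mul_cancel₀ h0] at h1
  linarith

/-- Bounded functions belong to the null space of the envelope norm. -/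
theorem norm_eq_zero_of_abs_le {f : WeakL1 (volume : Measure I)} {C : ℝ}
    (h : ∀ᵐ x, |f.1 x| ≤ C) : ‖f‖ = 0 := by
  obtain ⟨e, he⟩ := exists_eq_of_forall_abs_le (μ := (volume : Measure I)) (fun _ => 1)
    aestronglyMeasurable_const (C := 1) (by simp)
  refine le_antisymm ?_ (norm_nonneg _)
  calc ‖f‖ ≤ ‖C • e‖ := by
        refine norm_mono_of_ae ?_
        filter_upwards [h, he, AEEqFun.coeFn_smul C e.1] with x h1 h2 h3
        have h4 : (C • e).1 x = C := by
          refine Eq.trans h3 ?_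
          rw [Pi.smul_apply, h2, smul_eq_mul, mul_one]
        rw [h4]
        exact h1.trans (le_abs_self C)
    _ = 0 := by rw [norm_smul, norm_one_eq_zero e he, mul_zero]

/-- `ρ(f) ≤ limsup_{c → ∞} c λ{|f| > c}`: the part of `f` below any fixed level is bounded, hence
null for `ρ`, so only the distribution of large values matters. -/
theorem norm_le_of_eventually {f : WeakL1 (volume : Measure I)} {g : I → ℝ} (hg : Measurable g)
    (hfg : f.1 =ᵐ[volume] g) {r : ℝ} (hr : 0 ≤ r)
    (h : ∀ ε > 0, ∃ c₀, 0 < c₀ ∧ ∀ c ≥ c₀, c * volume.real {x | c < |g x|} ≤ r + ε) :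
    ‖f‖ ≤ r := by
  refine le_of_forall_pos_le_add fun ε hε => ?_
  obtain ⟨c₀, hc₀, H⟩ := h ε hε
  have hm : MeasurableSet {x | c₀ < |g x|} := measurableSet_lt measurable_const hg.abs
  obtain ⟨f₁, hf₁⟩ := exists_eq_of_forall_abs_le (μ := (volume : Measure I))
    ({x | c₀ < |g x|}ᶜ.indicator g) (hg.indicator hm.compl).aestronglyMeasurable
    (C := c₀) fun x => by
      by_cases hx : c₀ < |g x|
      · simp [hx, hc₀.le]
      · simp [hx, not_lt.1 hx]
  obtain ⟨f₂, hf₂, hq⟩ := exists_eq_of_forall_le (μ := (volume : Measure I))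
    (r := ENNReal.ofReal (r + ε))
    ({x | c₀ < |g x|}.indicator g) (hg.indicator hm).aestronglyMeasurable (by simp) fun c hc => by
      have h1 : {x | c < |({x | c₀ < |g x|}.indicator g) x|} ⊆ {x | max c c₀ < |g x|} := by
        intro x hx
        by_cases hx' : c₀ < |g x|
        · have : c < |g x| := by simpa [hx'] using hx
          exact max_lt this hx'
        · simp [hx'] at hx; linarith
      calc _ ≤ ENNReal.ofReal (max c c₀) * volume {x | max c c₀ < |g x|} := by
            gcongr; exact le_max_left _ _
        _ = ENNReal.ofReal (max c c₀ * volume.real {x | max c c₀ < |g x|}) := by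
            rw [ENNReal.ofReal_mul (by positivity), ofReal_measureReal]
        _ ≤ _ := ENNReal.ofReal_le_ofReal (H _ (le_max_right _ _))
  have h3 : ‖f‖ ≤ ‖f₁‖ + ‖f₂‖ := by
    refine norm_le_of_ae_abs_le_add ?_
    filter_upwards [hfg, hf₁, hf₂] with x h1 h2 h3
    rw [h1, h2, h3]
    by_cases hx : c₀ < |g x| <;> simp [hx]
  have h4 : ‖f₁‖ = 0 := by
    refine norm_eq_zero_of_abs_le (C := c₀) ?_
    filter_upwards [hf₁] with x hx
    rw [hx]
    by_cases hx : c₀ < |g x|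
    · simp [hx, hc₀.le]
    · simp [hx, not_lt.1 hx]
  have h5 : ‖f₂‖ ≤ r + ε := norm_le_of_weakQuasiNorm_le (by linarith) hq
  linarith

end WeakL1

/-! ### Lower estimates for the envelope norm -/

theorem lintegral_Ioc_ofReal_inv {a b : ℝ} (ha : 0 < a) (hab : a ≤ b) :
    ∫⁻ t in Ioc a b, ENNReal.ofReal t⁻¹ = ENNReal.ofReal (Real.log (b / a)) := by
  have h0 : IntervalIntegrable (fun t : ℝ => t⁻¹) volume a b :=
    intervalIntegrable_inv_iff.2 (Or.inr fun h => by
      rw [uIcc_of_le hab] at h; linarith [h.1])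
  rw [← ofReal_integral_eq_lintegral_ofReal
      ((intervalIntegrable_iff_integrableOn_Ioc_of_le hab).1 h0),
    ← intervalIntegral.integral_of_le hab, integral_inv_of_pos ha (ha.trans_le hab)]
  filter_upwards [ae_restrict_mem measurableSet_Ioc] with t ht
  exact inv_nonneg.2 (ha.trans ht.1).le

namespace WeakL1

variable {Ω : Type*} [MeasurableSpace Ω] {μ : Measure Ω} [IsFiniteMeasure μ]

/-- The layer cake formula, with `μ{|f| > t}` estimated by `μ S` for `t ≤ a` and by `1 / t` for
`a < t ≤ b`. -/
theorem setLIntegral_min_le_of_mem_quasiBall {f : WeakL1 μ} (hf : f ∈ quasiBall μ) {a b : ℝ}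
    (ha : 0 < a) (hab : a ≤ b) (S : Set Ω) :
    ∫⁻ x in S, ENNReal.ofReal (min |f.1 x| b) ∂μ ≤
      ENNReal.ofReal (a * μ.real S + Real.log (b / a)) := by
  have hq := (weakQuasiNorm_le_iff (f := f.1) (Filter.EventuallyEq.refl _ _)).1 hf
  have hlog : 0 ≤ Real.log (b / a) := Real.log_nonneg ((one_le_div ha).2 hab)
  rw [lintegral_eq_lintegral_meas_lt _
    (Filter.Eventually.of_forall fun x => le_min (abs_nonneg _) (ha.le.trans hab))
    ((AEEqFun.measurable _).abs.min measurable_const).aemeasurable]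
  have h1 : ∀ t ∈ Ioi (0 : ℝ), (μ.restrict S) {x | t < min |f.1 x| b} ≤
      (Ioc 0 a).indicator (fun _ => μ S) t +
        (Ioc a b).indicator (fun t => ENNReal.ofReal t⁻¹) t := by
    intro t ht
    rcases le_or_gt t a with hta | hta
    · rw [indicator_of_mem (show t ∈ Ioc 0 a from ⟨ht, hta⟩)]
      exact ((measure_mono (subset_univ _)).trans (by simp)).trans le_self_add
    · rcases le_or_gt t b with htb | htb
      · rw [indicator_of_mem (show t ∈ Ioc a b from ⟨hta, htb⟩)]
        refine le_trans ?_ le_add_self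
        have h2 : μ {x | t < |f.1 x|} ≤ ENNReal.ofReal t⁻¹ := by
          rw [ENNReal.ofReal_inv_of_pos ht, ENNReal.le_inv_iff_mul_le, mul_comm]
          exact hq t ht
        have h3 : {x | t < min |f.1 x| b} ⊆ {x | t < |f.1 x|} := fun x hx =>
          lt_of_lt_of_le (show t < min |f.1 x| b from hx) (min_le_left _ _)
        exact ((Measure.restrict_apply_le _ _).trans (measure_mono h3)).trans h2
      · have : {x | t < min |f.1 x| b} = ∅ := by
          ext x; simp [htb.le]
        rw [this, measure_empty]
        exact zero_le
  calc _ ≤ ∫⁻ t in Ioi (0 : ℝ), ((Ioc 0 a).indicator (fun _ => μ S) t +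
        (Ioc a b).indicator (fun t => ENNReal.ofReal t⁻¹) t) :=
        setLIntegral_mono' measurableSet_Ioi h1
    _ ≤ ∫⁻ t, ((Ioc 0 a).indicator (fun _ => μ S) t +
        (Ioc a b).indicator (fun t => ENNReal.ofReal t⁻¹) t) := setLIntegral_le_lintegral _ _
    _ = _ := by
      rw [lintegral_add_left (measurable_const.indicator measurableSet_Ioc),
        lintegral_indicator measurableSet_Ioc, lintegral_indicator measurableSet_Ioc,
        lintegral_Ioc_ofReal_inv ha hab, setLIntegral_const, Real.volume_Ioc, sub_zero,
        ENNReal.ofReal_add (by positivity) hlog, ENNReal.ofReal_mul ha.le, ofReal_measureReal,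
        mul_comm]

/-- A convex combination of functions in the ball of `q` still satisfies the logarithmic estimate
valid for a single one, up to a constant depending on the combination: this is where the gauge of
the convex hull, and not only the quasinorm, is seen by integrals over long windows of values. -/
theorem exists_setLIntegral_min_le {f : WeakL1 μ} (hf : f ∈ convexHull ℝ (quasiBall μ)) :
    ∃ C : ℝ, 0 ≤ C ∧ ∀ a b : ℝ, 0 < a → a ≤ b → ∀ S : Set Ω,
      ∫⁻ x in S, ENNReal.ofReal (min |f.1 x| b) ∂μ ≤
        ENNReal.ofReal (C * (a * μ.real S) + Real.log (b / a) + C) := by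
  let K : Set (WeakL1 μ) := {f | ∃ C : ℝ, 0 ≤ C ∧ ∀ a b : ℝ, 0 < a → a ≤ b → ∀ S : Set Ω,
      ∫⁻ x in S, ENNReal.ofReal (min |f.1 x| b) ∂μ ≤
        ENNReal.ofReal (C * (a * μ.real S) + Real.log (b / a) + C)}
  suffices h : convexHull ℝ (quasiBall μ) ⊆ K from h hf
  refine convexHull_min (fun f hf => ⟨1, zero_le_one, fun a b ha hab S =>
    (setLIntegral_min_le_of_mem_quasiBall hf ha hab S).trans
      (ENNReal.ofReal_le_ofReal (by linarith))⟩) ?_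
  refine convex_iff_forall_pos.2 fun f₁ hf₁ f₂ hf₂ p₁ p₂ hp₁ hp₂ hp => ?_
  obtain ⟨C₁, hC₁, H₁⟩ := hf₁
  obtain ⟨C₂, hC₂, H₂⟩ := hf₂
  have hl₁ : 0 ≤ -Real.log p₁ := by
    linarith [Real.log_nonpos hp₁.le (by linarith)]
  have hl₂ : 0 ≤ -Real.log p₂ := by
    linarith [Real.log_nonpos hp₂.le (by linarith)]
  -- Truncating `p f` at `b` is truncating `f` at `b / p`; this lengthens the window by the factor
  -- `1 / p` and accounts for the terms `-log p` in the constant.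
  refine ⟨C₁ + C₂ + -Real.log p₁ + -Real.log p₂, by positivity, fun a b ha hab S => ?_⟩
  have hb : 0 < b := ha.trans_le hab
  have part (p C : ℝ) (f : WeakL1 μ) (hp : 0 < p) (hp1 : p ≤ 1)
      (H : ∀ a b : ℝ, 0 < a → a ≤ b → ∀ S : Set Ω,
        ∫⁻ x in S, ENNReal.ofReal (min |f.1 x| b) ∂μ ≤
          ENNReal.ofReal (C * (a * μ.real S) + Real.log (b / a) + C)) :
      ∫⁻ x in S, ENNReal.ofReal (p * min |f.1 x| (b / p)) ∂μ ≤
        ENNReal.ofReal (p * (C * (a * μ.real S) + Real.log (b / a) + -Real.log p + C)) := by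
    have h1 : a ≤ b / p := hab.trans (le_div_self hb.le hp hp1)
    have h2 := H a (b / p) ha h1 S
    have h3 : Real.log (b / p / a) = Real.log (b / a) + -Real.log p := by
      rw [div_right_comm, Real.log_div (by positivity) hp.ne', sub_eq_add_neg]
    rw [h3, ← add_assoc] at h2
    simp_rw [ENNReal.ofReal_mul hp.le]
    rw [lintegral_const_mul' _ _ (by simp)]
    gcongr
  have hlog : 0 ≤ Real.log (b / a) := Real.log_nonneg ((one_le_div ha).2 hab)
  have hS : 0 ≤ a * μ.real S := by positivity
  calc ∫⁻ x in S, ENNReal.ofReal (min |(p₁ • f₁ + p₂ • f₂).1 x| b) ∂μ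
      ≤ ∫⁻ x in S, (ENNReal.ofReal (p₁ * min |f₁.1 x| (b / p₁)) +
          ENNReal.ofReal (p₂ * min |f₂.1 x| (b / p₂))) ∂μ := by
        refine lintegral_mono_ae (ae_restrict_of_ae ?_)
        filter_upwards [AEEqFun.coeFn_add (p₁ • f₁.1) (p₂ • f₂.1), AEEqFun.coeFn_smul p₁ f₁.1,
          AEEqFun.coeFn_smul p₂ f₂.1] with x h1 h2 h3
        rw [← ENNReal.ofReal_add (by positivity) (by positivity)]
        refine ENNReal.ofReal_le_ofReal ?_
        have h4 : (p₁ • f₁ + p₂ • f₂).1 x = p₁ * f₁.1 x + p₂ * f₂.1 x := by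
          refine Eq.trans h1 ?_
          rw [Pi.add_apply, h2, h3]; rfl
        have h5 : |p₁ * f₁.1 x + p₂ * f₂.1 x| ≤ p₁ * |f₁.1 x| + p₂ * |f₂.1 x| := by
          refine (abs_add_le _ _).trans ?_
          rw [abs_mul, abs_mul, abs_of_pos hp₁, abs_of_pos hp₂]
        rw [h4, mul_min_of_nonneg _ _ hp₁.le, mul_min_of_nonneg _ _ hp₂.le,
          mul_div_cancel₀ _ hp₁.ne', mul_div_cancel₀ _ hp₂.ne']
        have e1 : 0 ≤ p₁ * |f₁.1 x| := by positivity
        have e2 : 0 ≤ p₂ * |f₂.1 x| := by positivity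
        rcases le_total (p₁ * |f₁.1 x|) b with h6 | h6 <;>
          rcases le_total (p₂ * |f₂.1 x|) b with h7 | h7 <;>
          simp only [min_eq_left, min_eq_right, h6, h7]
        · exact (min_le_left _ _).trans h5
        · exact (min_le_right _ _).trans (by linarith)
        · exact (min_le_right _ _).trans (by linarith)
        · exact (min_le_right _ _).trans (by linarith)
    _ = ∫⁻ x in S, ENNReal.ofReal (p₁ * min |f₁.1 x| (b / p₁)) ∂μ +
          ∫⁻ x in S, ENNReal.ofReal (p₂ * min |f₂.1 x| (b / p₂)) ∂μ :=
        lintegral_add_left ((((AEEqFun.measurable _).abs.min measurable_const).const_mul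
          p₁).ennreal_ofReal) _
    _ ≤ _ := add_le_add (part p₁ C₁ f₁ hp₁ (by linarith) H₁) (part p₂ C₂ f₂ hp₂ (by linarith) H₂)
    _ ≤ _ := by
        rw [← ENNReal.ofReal_add (by positivity) (by positivity)]
        refine ENNReal.ofReal_le_ofReal ?_
        have k₁ : p₁ * (C₁ * (a * μ.real S) + -Real.log p₁ + C₁) ≤
            1 * (C₁ * (a * μ.real S) + -Real.log p₁ + C₁) := by gcongr; linarith
        have k₂ : p₂ * (C₂ * (a * μ.real S) + -Real.log p₂ + C₂) ≤
            1 * (C₂ * (a * μ.real S) + -Real.log p₂ + C₂) := by gcongr; linarith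
        have k₃ : p₁ * Real.log (b / a) + p₂ * Real.log (b / a) = Real.log (b / a) := by
          rw [← add_mul, hp, one_mul]
        have k₄ : 0 ≤ (-Real.log p₁ + -Real.log p₂) * (a * μ.real S) := by positivity
        nlinarith

/-- The lower half of the Cwikel–Fefferman formula: up to a bounded amount, the integral of `|f|`
over the set where `a < |f| < b` is at most `ρ(f) log (b / a)`. -/
theorem exists_setLIntegral_window_le (f : WeakL1 μ) {g : Ω → ℝ} (hg : Measurable g)
    (hfg : f.1 =ᵐ[μ] g) {r : ℝ} (hr : ‖f‖ < r) :
    ∃ C : ℝ, ∀ a b : ℝ, 0 < a → a ≤ b →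
      ∫⁻ x in {x | a < |g x| ∧ |g x| < b}, ENNReal.ofReal |g x| ∂μ ≤
        ENNReal.ofReal (r * Real.log (b / a) + C) := by
  rw [norm_eq_gauge] at hr
  obtain ⟨s, hs, hsr, f', hf', hf⟩ := exists_lt_of_gauge_lt absorbent_hull hr
  obtain ⟨C, hC, H⟩ := exists_setLIntegral_min_le hf'
  have hq : weakQuasiNorm μ f.1 < ∞ := f.2
  refine ⟨C * (weakQuasiNorm μ f.1).toReal + s * C, fun a b ha hab => ?_⟩
  set S := {x | a < |g x| ∧ |g x| < b}
  have hS : MeasurableSet S :=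
    (measurableSet_lt measurable_const hg.abs).inter (measurableSet_lt hg.abs measurable_const)
  have hlog : 0 ≤ Real.log (b / a) := Real.log_nonneg ((one_le_div ha).2 hab)
  have haS : a * μ.real S ≤ (weakQuasiNorm μ f.1).toReal := by
    rw [← ENNReal.toReal_ofReal ha.le, measureReal_def, ← ENNReal.toReal_mul]
    refine ENNReal.toReal_mono hq.ne ?_
    refine le_trans ?_ ((weakQuasiNorm_le_iff hfg).1 le_rfl a ha)
    gcongr
    exact fun x hx => hx.1
  have h1 := H (a / s) (b / s) (by positivity) (by gcongr) S
  calc ∫⁻ x in S, ENNReal.ofReal |g x| ∂μ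
      ≤ ∫⁻ x in S, ENNReal.ofReal s * ENNReal.ofReal (min |f'.1 x| (b / s)) ∂μ := by
        refine lintegral_mono_ae ?_
        filter_upwards [ae_restrict_of_ae hfg, ae_restrict_mem hS,
          ae_restrict_of_ae (AEEqFun.coeFn_smul s f'.1)] with x h1 h2 h3
        have h4 : g x = s * f'.1 x := by
          rw [← h1, ← hf]; exact h3
        rw [← ENNReal.ofReal_mul hs.le, mul_min_of_nonneg _ _ hs.le, mul_div_cancel₀ _ hs.ne']
        refine ENNReal.ofReal_le_ofReal (le_min ?_ h2.2.le)
        rw [h4, abs_mul, abs_of_pos hs]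
    _ ≤ ENNReal.ofReal s * ENNReal.ofReal
          (C * (a / s * μ.real S) + Real.log (b / s / (a / s)) + C) := by
        rw [lintegral_const_mul' _ _ (by simp)]; gcongr
    _ ≤ _ := by
        rw [← ENNReal.ofReal_mul hs.le]
        refine ENNReal.ofReal_le_ofReal ?_
        rw [div_div_div_cancel_right₀ hs.ne']
        have h5 : s * (C * (a / s * μ.real S)) = C * (a * μ.real S) := by field_simp
        have h6 : C * (a * μ.real S) ≤ C * (weakQuasiNorm μ f.1).toReal := by gcongr
        have h7 : s * Real.log (b / a) ≤ r * Real.log (b / a) := by gcongr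
        linarith

end WeakL1

/-! ### Countably many weights norming a Köthe space -/

namespace KotheSpace

variable {Ω : Type*} [MeasurableSpace Ω] {μ : Measure Ω} (X : KotheSpace μ)

/-- Since `X` is solid, membership in the unit ball of `X'` can be tested on absolute values. In
particular the ball is solid. -/
theorem mem_dualBall_iff {g : Ω →ₘ[μ] ℝ} :
    g ∈ X.dualBall ↔ ∀ f ∈ X.carrier, ∫⁻ x, ‖f x‖ₑ * ‖g x‖ₑ ∂μ ≤ ENNReal.ofReal (X.nrm f) := by
  constructor
  · rintro ⟨hg, h⟩ f hf
    -- Testing against `f` with its sign adjusted to that of `g` replaces `f g` by `|f g|`.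
    have hm : AEStronglyMeasurable (fun x => if 0 ≤ f x * g x then f x else -f x) μ :=
      (Measurable.ite (measurableSet_le measurable_const (f.measurable.mul g.measurable))
        f.measurable f.measurable.neg).aestronglyMeasurable
    have hf' := AEEqFun.coeFn_mk _ hm
    set f' : Ω →ₘ[μ] ℝ := AEEqFun.mk _ hm
    obtain ⟨hf'X, hle⟩ := X.solid f' f (AEEqFun.coeFn_le.1 (by
      filter_upwards [hf', AEEqFun.coeFn_abs f', AEEqFun.coeFn_abs f] with x h1 h2 h3
      rw [h2, h3, h1]
      split_ifs <;> simp)) hf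
    have h1 : (fun x => f' x * g x) =ᵐ[μ] fun x => |f x * g x| := by
      filter_upwards [hf'] with x hx
      rw [hx]
      split_ifs with h0
      · rw [abs_of_nonneg h0]
      · rw [abs_of_neg (not_le.1 h0), neg_mul]
    have h2 := (le_abs_self _).trans ((h f' hf'X).trans hle)
    rw [integral_congr_ae h1] at h2
    have h3 := ENNReal.ofReal_le_ofReal h2
    rw [ofReal_integral_eq_lintegral_ofReal (hg f hf).abs
      (Filter.Eventually.of_forall fun x => abs_nonneg _)] at h3
    refine le_trans (le_of_eq (lintegral_congr fun x => ?_)) h3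
    rw [← enorm_mul, Real.enorm_eq_ofReal_abs]
  · intro h
    have hint : ∀ f ∈ X.carrier, Integrable (fun x => f x * g x) μ := fun f hf => by
      refine ⟨(f.aestronglyMeasurable.mul g.aestronglyMeasurable), ?_⟩
      refine lt_of_le_of_lt ?_ ((h f hf).trans_lt ENNReal.ofReal_lt_top)
      exact le_of_eq (lintegral_congr fun x => enorm_mul _ _)
    refine ⟨hint, fun f hf => ?_⟩
    rw [← ENNReal.ofReal_le_ofReal_iff (X.nrm_nonneg f hf), ← Real.enorm_eq_ofReal_abs]
    refine (enorm_integral_le_lintegral_enorm _).trans ?_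
    simpa only [enorm_mul] using h f hf

theorem ofReal_nrm_le_of_dualNorming (hX : X.DualNorming) {f : Ω →ₘ[μ] ℝ} (hf : f ∈ X.carrier)
    {r : ℝ≥0∞} (h : ∀ g ∈ X.dualBall, ∫⁻ x, ‖f x‖ₑ * ‖g x‖ₑ ∂μ ≤ r) :
    ENNReal.ofReal (X.nrm f) ≤ r := by
  rcases eq_or_ne r ∞ with rfl | hr
  · exact le_top
  rw [ENNReal.ofReal_le_iff_le_toReal hr]
  refine (hX f hf).2 ?_
  rintro _ ⟨g, hg, rfl⟩
  have h1 : ‖∫ x, f x * g x ∂μ‖ₑ ≤ r := by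
    refine (enorm_integral_le_lintegral_enorm _).trans ?_
    simpa only [enorm_mul] using h g hg
  rw [Real.enorm_eq_ofReal_abs] at h1
  exact (ENNReal.ofReal_le_iff_le_toReal hr).1 h1

/-- Truncation to bounded functions on sets of finite measure reduces the unit ball of the Köthe
dual to its integrable elements. -/
theorem lintegral_mul_le_of_integrable_dualBall [SigmaFinite μ] {f : Ω →ₘ[μ] ℝ} {r : ℝ≥0∞}
    (h : ∀ g ∈ X.dualBall, Integrable g μ → ∫⁻ x, ‖f x‖ₑ * ‖g x‖ₑ ∂μ ≤ r) :
    ∀ g ∈ X.dualBall, ∫⁻ x, ‖f x‖ₑ * ‖g x‖ₑ ∂μ ≤ r := by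
  intro g hg
  let A : ℕ → Set Ω := fun j => spanningSets μ j ∩ {x | ‖g x‖ ≤ j}
  have hA (j : ℕ) : MeasurableSet (A j) :=
    (measurableSet_spanningSets μ j).inter (measurableSet_le g.measurable.norm measurable_const)
  have hAmono : Monotone A := fun i j hij x hx =>
    ⟨monotone_spanningSets μ hij hx.1,
      le_trans (show ‖g x‖ ≤ i from hx.2) (Nat.cast_le.2 hij)⟩
  have hAm (j : ℕ) : AEStronglyMeasurable ((A j).indicator g) μ :=
    g.aestronglyMeasurable.indicator (hA j)
  have hj (j : ℕ) : ∫⁻ x, ‖f x‖ₑ * ‖(A j).indicator g x‖ₑ ∂μ ≤ r := by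
    have h1 := AEEqFun.coeFn_mk _ (hAm j)
    have hg' : AEEqFun.mk _ (hAm j) ∈ X.dualBall := by
      rw [mem_dualBall_iff] at hg ⊢
      refine fun k hk => le_trans (lintegral_mono_ae ?_) (hg k hk)
      filter_upwards [h1] with x hx
      rw [hx]
      gcongr
      exact enorm_indicator_le_enorm_self _ _
    have hi : Integrable (AEEqFun.mk _ (hAm j)) μ := by
      rw [integrable_congr h1, integrable_indicator_iff (hA j)]
      refine IntegrableOn.of_bound ((measure_mono inter_subset_left).trans_lt
        (measure_spanningSets_lt_top μ j)) g.measurable.aestronglyMeasurable j ?_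
      filter_upwards [ae_restrict_mem (hA j)] with x hx
      exact hx.2
    refine le_trans (le_of_eq (lintegral_congr_ae ?_)) (h _ hg' hi)
    filter_upwards [h1] with x hx
    rw [hx]
  have hlim : ∀ x, Filter.Tendsto (fun j => ‖f x‖ₑ * ‖(A j).indicator g x‖ₑ) Filter.atTop
      (𝓝 (‖f x‖ₑ * ‖g x‖ₑ)) := by
    intro x
    obtain ⟨i, hi⟩ := mem_iUnion.1 ((iUnion_spanningSets μ).symm ▸ mem_univ x :
      x ∈ ⋃ i, spanningSets μ i)
    obtain ⟨k, hk⟩ := exists_nat_ge ‖g x‖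
    refine tendsto_const_nhds.congr' ?_
    filter_upwards [Filter.eventually_ge_atTop (max i k)] with j hj
    have : x ∈ A j := ⟨monotone_spanningSets μ ((le_max_left _ _).trans hj) hi,
      hk.trans (Nat.cast_le.2 ((le_max_right _ _).trans hj))⟩
    rw [indicator_of_mem this]
  calc _ = ∫⁻ x, Filter.liminf (fun j => ‖f x‖ₑ * ‖(A j).indicator g x‖ₑ) Filter.atTop ∂μ :=
        lintegral_congr fun x => (hlim x).liminf_eq.symm
    _ ≤ Filter.liminf (fun j => ∫⁻ x, ‖f x‖ₑ * ‖(A j).indicator g x‖ₑ ∂μ) Filter.atTop :=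
        lintegral_liminf_le fun j =>
          f.measurable.enorm.mul (g.measurable.indicator (hA j)).enorm
    _ ≤ r := Filter.liminf_le_of_le (by isBoundedDefault) fun b hb => by
        obtain ⟨j, hb⟩ := hb.exists
        exact hb.trans (hj j)

/-- The integrable functions in the unit ball of the Köthe dual contain an `L¹`-dense sequence; by
Fatou's lemma, applied along an almost everywhere convergent subsequence, it computes the same norms
as the whole ball. -/
theorem exists_seq_norming [SigmaFinite μ] [MeasurableSpace.CountablyGenerated Ω]
    (hX : X.DualNorming) :
    ∃ w : ℕ → Ω → ℝ, (∀ n, Measurable (w n)) ∧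
      ∀ f ∈ X.carrier, ⨆ n, ∫⁻ x, ‖f x‖ₑ * ‖w n x‖ₑ ∂μ = ENNReal.ofReal (X.nrm f) := by
  let D : Set (Lp ℝ 1 μ) := {g | (g : Ω →ₘ[μ] ℝ) ∈ X.dualBall}
  have h0 : (0 : Lp ℝ 1 μ) ∈ D := by
    change ((0 : Lp ℝ 1 μ) : Ω →ₘ[μ] ℝ) ∈ X.dualBall
    rw [mem_dualBall_iff]
    intro f _
    refine le_trans (le_of_eq ?_) zero_le
    refine lintegral_eq_zero_of_ae_eq_zero ?_
    filter_upwards [AEEqFun.coeFn_zero (β := ℝ) (μ := μ)] with x hx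
    simp [hx]
  have : Nonempty D := ⟨⟨0, h0⟩⟩
  have : Fact ((1 : ℝ≥0∞) ≠ ∞) := ⟨ENNReal.one_ne_top⟩
  let d : ℕ → D := TopologicalSpace.denseSeq D
  refine ⟨fun n => ((d n : Lp ℝ 1 μ) : Ω → ℝ), fun n => AEEqFun.measurable _, fun f hf => ?_⟩
  refine le_antisymm (iSup_le fun n => (X.mem_dualBall_iff).1 (d n).2 f hf) ?_
  refine X.ofReal_nrm_le_of_dualNorming hX hf (X.lintegral_mul_le_of_integrable_dualBall ?_)
  intro g hg hgi
  have hgLp : MemLp g 1 μ := memLp_one_iff_integrable.2 hgi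
  let G : D := ⟨hgLp.toLp g, by
    change (hgLp.toLp g : Ω →ₘ[μ] ℝ) ∈ X.dualBall
    have : (hgLp.toLp g : Ω →ₘ[μ] ℝ) = g := AEEqFun.ext hgLp.coeFn_toLp
    rwa [this]⟩
  have hGcl : G ∈ closure (range d) := TopologicalSpace.denseRange_denseSeq D G
  obtain ⟨s, hs, hsG⟩ := mem_closure_iff_seq_limit.1 hGcl
  have h1 : Filter.Tendsto (fun i => ((s i : D) : Lp ℝ 1 μ)) Filter.atTop (𝓝 (G : Lp ℝ 1 μ)) :=
    (continuous_subtype_val.tendsto G).comp hsG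
  have h2 := tendstoInMeasure_of_tendsto_Lp h1
  obtain ⟨ns, -, hns⟩ := h2.exists_seq_tendsto_ae
  have hlim : ∀ᵐ x ∂μ, Filter.Tendsto (fun i => ‖f x‖ₑ * ‖((s (ns i) : D) : Lp ℝ 1 μ) x‖ₑ)
      Filter.atTop (𝓝 (‖f x‖ₑ * ‖g x‖ₑ)) := by
    filter_upwards [hns, hgLp.coeFn_toLp] with x h1 h2
    rw [← h2]
    exact ENNReal.Tendsto.const_mul h1.enorm (Or.inr enorm_ne_top)
  calc _ = ∫⁻ x, Filter.liminf (fun i => ‖f x‖ₑ * ‖((s (ns i) : D) : Lp ℝ 1 μ) x‖ₑ)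
          Filter.atTop ∂μ := by
        refine lintegral_congr_ae ?_
        filter_upwards [hlim] with x hx using hx.liminf_eq.symm
    _ ≤ Filter.liminf (fun i => ∫⁻ x, ‖f x‖ₑ * ‖((s (ns i) : D) : Lp ℝ 1 μ) x‖ₑ ∂μ)
          Filter.atTop :=
        lintegral_liminf_le fun i => f.measurable.enorm.mul (AEEqFun.measurable _).enorm
    _ ≤ _ := Filter.liminf_le_of_le (by isBoundedDefault) fun b hb => by
        obtain ⟨i, hb⟩ := hb.exists
        obtain ⟨n, hn⟩ := hs (ns i)
        refine hb.trans ?_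
        rw [← hn]
        exact le_iSup (fun n => ∫⁻ x, ‖f x‖ₑ * ‖((d n : Lp ℝ 1 μ) : Ω → ℝ) x‖ₑ ∂μ) n

/-- The norming weights, taken relative to a probability measure. -/
theorem exists_probability_norming [SigmaFinite μ] [MeasurableSpace.CountablyGenerated Ω]
    (hμ : μ ≠ 0) (hX : X.DualNorming) :
    ∃ P : Measure Ω, IsProbabilityMeasure P ∧ P ≪ μ ∧ ∃ v : ℕ → Ω → ℝ≥0, (∀ n, Measurable (v n)) ∧
      ∀ f ∈ X.carrier, ⨆ n, ∫⁻ x, ‖f x‖ₑ * v n x ∂P = ENNReal.ofReal (X.nrm f) := by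
  obtain ⟨w, hw, H⟩ := X.exists_seq_norming hX
  obtain ⟨h, hpos, hm, hlt⟩ := exists_pos_lintegral_lt_of_sigmaFinite μ one_ne_zero
  have hm' : Measurable fun x => (h x : ℝ≥0∞) := hm.coe_nnreal_ennreal
  set c := ∫⁻ x, h x ∂μ
  have hc0 : c ≠ 0 := by
    intro hc
    rw [lintegral_eq_zero_iff hm'] at hc
    refine hμ (ae_eq_bot.1 (Filter.eventually_false_iff_eq_bot.1 ?_))
    filter_upwards [hc] with x hx
    exact (hpos x).ne' (by simpa using hx)
  have hct : c ≠ ∞ := (hlt.trans ENNReal.one_lt_top).ne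
  have hct' : c⁻¹ ≠ ∞ := ENNReal.inv_ne_top.2 hc0
  refine ⟨c⁻¹ • μ.withDensity fun x => h x, ⟨?_⟩, ?_, fun n x => c.toNNReal * (‖w n x‖₊ / h x),
    fun n => ((hw n).nnnorm.div hm).const_mul _, fun f hf => ?_⟩
  · rw [Measure.smul_apply, withDensity_apply _ MeasurableSet.univ, Measure.restrict_univ,
      smul_eq_mul, ENNReal.inv_mul_cancel hc0 hct]
  · exact (Measure.smul_absolutelyContinuous).trans (withDensity_absolutelyContinuous _ _)
  · rw [← H f hf]
    refine iSup_congr fun n => ?_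
    have hfm : Measurable fun x => ‖f x‖ₑ * ((c.toNNReal * (‖w n x‖₊ / h x) : ℝ≥0) : ℝ≥0∞) :=
      f.measurable.enorm.mul (((hw n).nnnorm.div hm).const_mul _).coe_nnreal_ennreal
    rw [lintegral_smul_measure, lintegral_withDensity_eq_lintegral_mul _ hm' hfm, smul_eq_mul,
      ← lintegral_const_mul' _ _ hct']
    refine lintegral_congr fun x => ?_
    have hx : (h x : ℝ≥0∞) ≠ 0 := by simpa using (hpos x).ne'
    rw [Pi.mul_apply, ENNReal.coe_mul, ENNReal.coe_div (hpos x).ne', ENNReal.coe_toNNReal hct,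
      enorm_eq_nnnorm (w n x)]
    calc _ = (c⁻¹ * c) * (‖f x‖ₑ * ((h x : ℝ≥0∞) * ((‖w n x‖₊ : ℝ≥0∞) / h x))) := by ring
      _ = _ := by
        rw [ENNReal.inv_mul_cancel hc0 hct, one_mul, ENNReal.mul_div_cancel hx ENNReal.coe_ne_top]

end KotheSpace

/-! ### Distribution of values over blocks -/

/-- A probability measure on `ℕ` whose tails are negligible against the truncation levels
`(k + 1) e^{2 (k + 1)} / π{k}`. It is the law of `⌊√(-log r / 2)⌋` for uniform `r`, so that
`π[k, ∞) = e^{-2 k²}`. -/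
theorem exists_rapidly_decreasing_probability :
    ∃ π : Measure ℕ, IsProbabilityMeasure π ∧ (∀ k, 0 < π.real {k}) ∧
      Filter.Tendsto (fun k : ℕ => (k + 1) * Real.exp (2 * (k + 1)) / π.real {k} * π.real (Ioi k))
        Filter.atTop (𝓝 0) := by
  let κ : I → ℕ := fun r => ⌊√(-Real.log r / 2)⌋₊
  have hκ : Measurable κ := by fun_prop
  let π := (volume : Measure I).map κ
  have hπ : IsProbabilityMeasure π := Measure.isProbabilityMeasure_map hκ.aemeasurable
  let t : ℕ → ℝ := fun k => Real.exp (-2 * (k : ℝ) ^ 2)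
  have ht1 (k : ℕ) : t k ≤ 1 := Real.exp_le_one_iff.2 (by nlinarith [sq_nonneg (k : ℝ)])
  have ht (k : ℕ) : π.real (Ici k) = t k := by
    have h1 : κ ⁻¹' Ici k =ᵐ[volume] Iic (⟨t k, (Real.exp_pos _).le, ht1 k⟩ : I) := by
      have h0 : ∀ᵐ r : I, r ≠ 0 := by simp [ae_iff]
      filter_upwards [h0] with r hr
      have hr0 : 0 < (r : ℝ) := lt_of_le_of_ne r.2.1 fun h => hr (Subtype.ext h.symm)
      refine propext ?_
      change k ≤ ⌊√(-Real.log r / 2)⌋₊ ↔ r ≤ ⟨t k, _⟩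
      rw [Nat.le_floor_iff (Real.sqrt_nonneg _), Real.le_sqrt (Nat.cast_nonneg k)
        (by linarith [Real.log_nonpos hr0.le r.2.2]), ← Subtype.coe_le_coe,
        ← Real.log_le_iff_le_exp hr0]
      constructor <;> intro h <;> linarith
    rw [measureReal_def, Measure.map_apply hκ measurableSet_Ici, measure_congr h1,
      unitInterval.volume_Iic, ENNReal.toReal_ofReal (Real.exp_pos _).le]
  have hq (k : ℕ) : t (k + 1) = t k * Real.exp (-(4 * k + 2)) := by
    simp only [t]
    rw [← Real.exp_add]; congr 1; push_cast; ring
  have hIoi (k : ℕ) : Ioi k = Ici (k + 1) := rfl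
  have hp (k : ℕ) : π.real {k} = t k * (1 - Real.exp (-(4 * k + 2))) := by
    have h1 : ({k} : Set ℕ) = Ici k \ Ici (k + 1) := by
      ext j; simp; omega
    rw [h1, measureReal_sdiff (Ici_subset_Ici.2 k.le_succ) measurableSet_Ici, ht, ht, hq]; ring
  have he (k : ℕ) : 1 / 2 ≤ 1 - Real.exp (-(4 * k + 2)) := by
    have h1 : Real.exp (-(4 * k + 2)) ≤ Real.exp (-1) :=
      Real.exp_le_exp.2 (by linarith [(Nat.cast_nonneg k : (0 : ℝ) ≤ k)])
    have h2 : Real.exp (-1) ≤ 1 / 2 := by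
      rw [Real.exp_neg, ← one_div]
      exact one_div_le_one_div_of_le two_pos (by linarith [Real.add_one_le_exp 1])
    linarith
  have ht0 (k : ℕ) : 0 < t k := Real.exp_pos _
  refine ⟨π, hπ, fun k => ?_, ?_⟩
  · rw [hp]; exact mul_pos (ht0 k) (by linarith [he k])
  · refine squeeze_zero (g := fun k : ℕ => 2 * Real.exp (-(k : ℝ))) (fun k => by positivity)
      (fun k => ?_) ?_
    · rw [hIoi, ht, hp, hq]
      have h1 : 0 < 1 - Real.exp (-(4 * k + 2)) := by linarith [he k]
      have h2 : ((k : ℝ) + 1) * Real.exp (2 * (k + 1)) /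
          (t k * (1 - Real.exp (-(4 * k + 2)))) * (t k * Real.exp (-(4 * k + 2))) =
          (k + 1) * (Real.exp (2 * (k + 1)) * Real.exp (-(4 * k + 2))) /
            (1 - Real.exp (-(4 * k + 2))) := by
        field_simp [(ht0 k).ne']
      rw [h2, ← Real.exp_add, div_le_iff₀ h1]
      have h3 : 2 * ((k : ℝ) + 1) + -(4 * k + 2) = -k + -k := by ring
      rw [h3, Real.exp_add]
      have h4 : ((k : ℝ) + 1) * Real.exp (-k) ≤ 1 := by
        rw [Real.exp_neg, ← div_eq_mul_inv]
        exact div_le_one_of_le₀ (Real.add_one_le_exp _) (Real.exp_pos _).le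
      have h5 := Real.exp_pos (-(k : ℝ))
      calc _ = ((k : ℝ) + 1) * Real.exp (-k) * Real.exp (-k) := by ring
        _ ≤ 1 * Real.exp (-k) := by gcongr
        _ = 2 * Real.exp (-k) * (1 / 2) := by ring
        _ ≤ _ := by gcongr; exact he k
    · simpa using (Real.tendsto_exp_neg_atTop_nhds_zero.comp
        tendsto_natCast_atTop_atTop).const_mul 2

section Block

variable {Ω : Type*} [MeasurableSpace Ω] (P : Measure Ω) (π : Measure ℕ)
  [IsProbabilityMeasure π]

/-- The law of a point of `Ω`, a block number and an independent uniform variable. -/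
noncomputable def blockMeasure : Measure (Ω × ℕ × ℝ) :=
  P.prod (π.prod (volume.restrict (Ioo 0 1)))

instance : IsProbabilityMeasure (volume.restrict (Ioo (0 : ℝ) 1)) := ⟨by simp⟩

instance [IsProbabilityMeasure P] : IsProbabilityMeasure (blockMeasure P π) := by
  unfold blockMeasure; infer_instance

variable {P π}

/-- Dividing by an independent uniform variable turns an integrable function into one whose
distribution function decays like `‖u‖₁ / c`; the factor `π{k}` compensates for the restriction to
the `k`-th block. -/
theorem mul_blockMeasure_lt_le {u : Ω → ℝ} (hu : Measurable u) {k : ℕ}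
    (hk : 0 < π.real {k}) {c : ℝ} (hc : 0 < c) :
    ENNReal.ofReal c * blockMeasure P π {y | y.2.1 = k ∧ c < |u y.1 / (π.real {k} * y.2.2)|} ≤
      ∫⁻ x, ENNReal.ofReal |u x| ∂P := by
  have hF : Measurable fun y : Ω × ℕ × ℝ => u y.1 / (π.real {k} * y.2.2) := by fun_prop
  have hm : MeasurableSet {y : Ω × ℕ × ℝ | y.2.1 = k ∧ c < |u y.1 / (π.real {k} * y.2.2)|} :=
    (measurableSet_eq_fun (by fun_prop) measurable_const).inter
      (measurableSet_lt measurable_const hF.abs)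
  rw [blockMeasure, Measure.prod_apply hm, ← lintegral_const_mul' _ _ ENNReal.ofReal_ne_top]
  refine lintegral_mono fun x => ?_
  have h1 : Prod.mk x ⁻¹' {y : Ω × ℕ × ℝ | y.2.1 = k ∧ c < |u y.1 / (π.real {k} * y.2.2)|} =
      {k} ×ˢ {s : ℝ | c < |u x / (π.real {k} * s)|} := by
    ext ⟨j, s⟩; simp
  have h2 : volume.restrict (Ioo 0 1) {s : ℝ | c < |u x / (π.real {k} * s)|} ≤
      ENNReal.ofReal (|u x| / (π.real {k} * c)) := by
    rw [Measure.restrict_apply' measurableSet_Ioo]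
    calc _ ≤ volume (Ioo 0 (|u x| / (π.real {k} * c))) := by
          refine measure_mono fun s hs => ?_
          have h3 : c < |u x / (π.real {k} * s)| := hs.1
          have h4 : 0 < s := hs.2.1
          refine ⟨h4, ?_⟩
          rw [abs_div, abs_of_pos (by positivity : 0 < π.real {k} * s)] at h3
          rw [lt_div_iff₀ (by positivity)] at h3 ⊢
          linarith
      _ = _ := by rw [Real.volume_Ioo, sub_zero]
  rw [h1, Measure.prod_prod, ← ofReal_measureReal (μ := π) (s := {k})]
  calc _ ≤ ENNReal.ofReal c * (ENNReal.ofReal (π.real {k}) *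
        ENNReal.ofReal (|u x| / (π.real {k} * c))) := by gcongr
    _ = _ := by
      rw [← ENNReal.ofReal_mul hk.le, ← ENNReal.ofReal_mul hc.le]
      congr 1; field_simp

/-- The integral over a window of values grows logarithmically, at the rate given by the part of
`u` that the window sees entirely. -/
theorem mul_lintegral_le_blockMeasure {u : Ω → ℝ} (hu : Measurable u) {k : ℕ}
    (hk : 0 < π.real {k}) {a b : ℝ} (ha : 0 < a) (hab : a ≤ b) :
    ENNReal.ofReal (Real.log (b / a)) *
        ∫⁻ x in {x | |u x| ≤ π.real {k} * a}, ENNReal.ofReal |u x| ∂P ≤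
      ∫⁻ y in {y | y.2.1 = k ∧ a < |u y.1 / (π.real {k} * y.2.2)| ∧
          |u y.1 / (π.real {k} * y.2.2)| < b},
        ENNReal.ofReal |u y.1 / (π.real {k} * y.2.2)| ∂(blockMeasure P π) := by
  have hb : 0 < b := ha.trans_le hab
  have hF' : Measurable fun y : Ω × ℕ × ℝ => |u y.1 / (π.real {k} * y.2.2)| := by
    fun_prop
  have hm : MeasurableSet {y : Ω × ℕ × ℝ | y.2.1 = k ∧ a < |u y.1 / (π.real {k} * y.2.2)| ∧
      |u y.1 / (π.real {k} * y.2.2)| < b} :=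
    (measurableSet_eq_fun (by fun_prop) measurable_const).inter
      ((measurableSet_lt measurable_const hF').inter (measurableSet_lt hF' measurable_const))
  have hF : Measurable fun y : Ω × ℕ × ℝ => ENNReal.ofReal |u y.1 / (π.real {k} * y.2.2)| :=
    hF'.ennreal_ofReal
  rw [← lintegral_indicator hm, blockMeasure, lintegral_prod _ (hF.indicator hm).aemeasurable,
    ← lintegral_const_mul' _ _ ENNReal.ofReal_ne_top,
    ← lintegral_indicator (measurableSet_le hu.abs measurable_const)]
  refine lintegral_mono fun x => ?_
  by_cases hx : |u x| ≤ π.real {k} * a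
  swap
  · rw [indicator_of_notMem (by simpa using hx)]; exact zero_le
  rw [indicator_of_mem (by simpa using hx)]
  rcases (abs_nonneg (u x)).eq_or_lt with h0 | h0
  · rw [← h0]; simp
  set p := π.real {k}
  have hG : Measurable fun z : ℕ × ℝ =>
      ({y : Ω × ℕ × ℝ | y.2.1 = k ∧ a < |u y.1 / (p * y.2.2)| ∧ |u y.1 / (p * y.2.2)| < b}.indicator
        (fun y => ENNReal.ofReal |u y.1 / (p * y.2.2)|)) (x, z) :=
    (hF.indicator hm).comp (by fun_prop)
  rw [lintegral_prod _ hG.aemeasurable]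
  have hlog : Real.log (b / a) = Real.log (|u x| / (p * a) / (|u x| / (p * b))) := by
    congr 1; field_simp
  have hle : |u x| / (p * b) ≤ |u x| / (p * a) := by gcongr
  calc ENNReal.ofReal (Real.log (b / a)) * ENNReal.ofReal |u x|
      = ∫⁻ s in Ioo (|u x| / (p * b)) (|u x| / (p * a)),
          ENNReal.ofReal |u x| * ENNReal.ofReal s⁻¹ := by
        rw [lintegral_const_mul' _ _ ENNReal.ofReal_ne_top, setLIntegral_congr Ioo_ae_eq_Ioc,
          lintegral_Ioc_ofReal_inv (by positivity) hle, hlog, mul_comm]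
    _ = ∫⁻ j in {k}, ∫⁻ s in Ioo (|u x| / (p * b)) (|u x| / (p * a)),
          ENNReal.ofReal (|u x| / (p * s)) ∂volume ∂π := by
        rw [setLIntegral_const, ← ofReal_measureReal (μ := π) (s := {k}),
          ← lintegral_mul_const' _ _ ENNReal.ofReal_ne_top]
        refine lintegral_congr fun s => ?_
        rw [← ENNReal.ofReal_mul h0.le, ← ENNReal.ofReal_mul' hk.le]
        congr 1
        field_simp
    _ ≤ _ := by
        rw [← lintegral_indicator (MeasurableSet.singleton k)]
        refine lintegral_mono fun j => ?_
        by_cases hj : j = k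
        swap
        · rw [indicator_of_notMem (by simpa using hj)]; exact zero_le
        rw [indicator_of_mem (by simpa using hj), ← lintegral_indicator measurableSet_Ioo,
          ← lintegral_indicator measurableSet_Ioo]
        refine lintegral_mono fun s => ?_
        by_cases hs : s ∈ Ioo (|u x| / (p * b)) (|u x| / (p * a))
        swap
        · rw [indicator_of_notMem hs]; exact zero_le
        have hs0 : 0 < s := lt_trans (by positivity) hs.1
        have hs1 : s < 1 := hs.2.trans_le (div_le_one_of_le₀ hx (by positivity))
        have e1 : a < |u x| / (p * s) := by
          have := hs.2
          rw [lt_div_iff₀ (by positivity)] at this ⊢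
          linarith
        have e2 : |u x| / (p * s) < b := by
          have := hs.1
          rw [div_lt_iff₀ (by positivity)] at this ⊢
          linarith
        have e3 : |u x / (p * s)| = |u x| / (p * s) := by
          rw [abs_div, abs_of_pos (by positivity : 0 < p * s)]
        rw [← e3] at e1 e2
        rw [indicator_of_mem hs, indicator_of_mem (show s ∈ Ioo (0 : ℝ) 1 from ⟨hs0, hs1⟩),
          indicator_of_mem (by exact ⟨hj, e1, e2⟩)]
        exact (congrArg ENNReal.ofReal e3).ge

end Block

/-! ### Functions built from blocks -/

namespace WeakL1

/-- Functions on `[0,1]` split into blocks `{κ = k}`: if `|g| ≤ C B k` on the `k`-th block, where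
the later blocks are negligible in comparison with `B k`, then at each level `c` essentially one
block contributes to `c λ{|g| > c}`. -/
theorem exists_forall_ge_mul_measure_le {κ : I → ℕ} {g : I → ℝ} {B R : ℕ → ℝ} {C r : ℝ}
    (hC : 0 ≤ C) (hB : ∀ k, 0 ≤ B k) (hgB : ∀ x, |g x| ≤ C * B (κ x))
    (htail : Filter.Tendsto (fun k => B k * volume.real {x | k < κ x}) Filter.atTop (𝓝 0))
    (hR : ∀ k, ∀ c : ℝ, 0 < c → c * volume.real {x | κ x = k ∧ c < |g x|} ≤ R k)
    (hRr : ∀ ε > 0, ∀ᶠ k in Filter.atTop, R k ≤ r + ε) (hr : 0 ≤ r) :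
    ∀ ε > 0, ∃ c₀, 0 < c₀ ∧ ∀ c ≥ c₀, c * volume.real {x | c < |g x|} ≤ r + ε := by
  intro ε hε
  have h1 : ∀ᶠ k in Filter.atTop, C * (B k * volume.real {x | k < κ x}) ≤ ε / 2 := by
    have h := htail.const_mul C
    rw [mul_zero] at h
    exact h.eventually_le_const (by positivity)
  obtain ⟨K, hK⟩ := Filter.eventually_atTop.1 (h1.and (hRr (ε / 2) (by positivity)))
  refine ⟨1 + ∑ j ∈ Finset.range K, C * B j,
    add_pos_of_pos_of_nonneg one_pos (Finset.sum_nonneg fun j _ => mul_nonneg hC (hB j)),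
    fun c hc => ?_⟩
  have hc0 : 0 < c := lt_of_lt_of_le
    (add_pos_of_pos_of_nonneg one_pos (Finset.sum_nonneg fun j _ => mul_nonneg hC (hB j))) hc
  by_cases hk : ∃ k, c < C * B k
  swap
  · have : {x | c < |g x|} = ∅ := by
      ext x
      simpa using (hgB x).trans (not_lt.1 fun h => hk ⟨_, h⟩)
    rw [this]; simp; positivity
  classical
  -- The first block whose values can exceed `c`.
  set k := Nat.find hk
  have hck : c < C * B k := Nat.find_spec hk
  have hKk : K ≤ k := by
    by_contra! hlt
    have h2 : C * B k ≤ ∑ j ∈ Finset.range K, C * B j :=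
      Finset.single_le_sum (f := fun j => C * B j) (fun j _ => mul_nonneg hC (hB j))
        (Finset.mem_range.2 hlt)
    linarith
  have hsub : {x | c < |g x|} ⊆ {x | κ x = k ∧ c < |g x|} ∪ {x | k < κ x} := by
    intro x hx
    have hx' : c < |g x| := hx
    rcases lt_trichotomy (κ x) k with h | h | h
    · exact absurd (hx'.trans_le (hgB x)) (Nat.find_min hk h)
    · exact Or.inl ⟨h, hx'⟩
    · exact Or.inr h
  have h3 := (measureReal_mono hsub).trans
    (measureReal_union_le (μ := volume) {x | κ x = k ∧ c < |g x|} {x | k < κ x})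
  calc c * volume.real {x | c < |g x|}
      ≤ c * (volume.real {x | κ x = k ∧ c < |g x|} + volume.real {x | k < κ x}) := by gcongr
    _ = c * volume.real {x | κ x = k ∧ c < |g x|} + c * volume.real {x | k < κ x} := mul_add _ _ _
    _ ≤ R k + C * B k * volume.real {x | k < κ x} := by
        gcongr
        exact hR k c hc0
    _ ≤ (r + ε / 2) + ε / 2 := by
        rw [mul_assoc]
        exact add_le_add (hK k hKk).2 (hK k hKk).1
    _ = r + ε := by ring

theorem weakQuasiNorm_lt_top_of_eventually {f : I →ₘ[volume] ℝ} {g : I → ℝ} (hfg : f =ᵐ[volume] g)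
    {r c₀ : ℝ} (hc₀ : 0 < c₀) (h : ∀ c ≥ c₀, c * volume.real {x | c < |g x|} ≤ r) :
    weakQuasiNorm volume f < ∞ := by
  refine lt_of_le_of_lt ((weakQuasiNorm_le_iff hfg (r := ENNReal.ofReal (max r c₀))).2
    fun c hc => ?_) ENNReal.ofReal_lt_top
  rw [← ofReal_measureReal, ← ENNReal.ofReal_mul hc.le]
  refine ENNReal.ofReal_le_ofReal ?_
  rcases le_or_gt c₀ c with hcc | hcc
  · exact (h c hcc).trans (le_max_left _ _)
  · calc c * volume.real {x | c < |g x|} ≤ c₀ * 1 := by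
          gcongr
          exact measureReal_le_one
      _ ≤ _ := by rw [mul_one]; exact le_max_right _ _

end WeakL1

namespace KotheSpace

variable {Ω : Type*} [MeasurableSpace Ω] {μ : Measure Ω}

/-- The data from which a Köthe space is embedded: a sequence of weights `v n` computing its norm
relative to a probability measure `P`, block probabilities `π`, and a map `φ` realising on `[0,1]`
the law of a point of `Ω`, a block number and an independent uniform variable. -/
structure NormingBlocks (X : KotheSpace μ) where
  P : Measure Ω
  isProbabilityMeasure_P : IsProbabilityMeasure P
  absolutelyContinuous : P ≪ μ
  v : ℕ → Ω → ℝ≥0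
  measurable_v : ∀ n, Measurable (v n)
  iSup_eq : ∀ f ∈ X.carrier, ⨆ n, ∫⁻ x, ‖f x‖ₑ * v n x ∂P = ENNReal.ofReal (X.nrm f)
  π : Measure ℕ
  isProbabilityMeasure_π : IsProbabilityMeasure π
  pos : ∀ k, 0 < π.real {k}
  tail : Filter.Tendsto
    (fun k : ℕ => (k + 1) * Real.exp (2 * (k + 1)) / π.real {k} * π.real (Ioi k))
    Filter.atTop (𝓝 0)
  φ : I → Ω × ℕ × ℝ
  measurable_φ : Measurable φ
  map_φ : (volume : Measure I).map φ = blockMeasure P π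

attribute [instance] NormingBlocks.isProbabilityMeasure_P NormingBlocks.isProbabilityMeasure_π

theorem nonempty_normingBlocks [StandardBorelSpace Ω] [SigmaFinite μ] (hμ : μ ≠ 0)
    (X : KotheSpace μ) (hX : X.DualNorming) : Nonempty X.NormingBlocks := by
  obtain ⟨P, hP, hPμ, v, hv, H⟩ := X.exists_probability_norming hμ hX
  obtain ⟨π, hπ, hpos, htail⟩ := exists_rapidly_decreasing_probability
  have : Nonempty Ω := nonempty_of_isProbabilityMeasure P
  obtain ⟨φ, hφ, hmap⟩ := (blockMeasure P π).exists_measurable_map_eq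
  exact ⟨⟨P, hP, hPμ, v, hv, H, π, hπ, hpos, htail, φ, hφ, hmap⟩⟩

namespace NormingBlocks

variable {X : KotheSpace μ} (B : X.NormingBlocks)

/-- The block number of a point of `[0,1]`. -/
def block (x : I) : ℕ := (B.φ x).2.1

/-- The weight used on the `k`-th block; every weight is used on infinitely many blocks. -/
def weight (k : ℕ) : Ω → ℝ≥0 := B.v (Nat.unpair k).1

/-- The function `h v / (π{k} s)` on the `k`-th block, before truncation. The uniform variable `s`
is positive almost surely; the absolute value makes the factor of `h` nonnegative everywhere. -/
noncomputable def spread (h : Ω → ℝ) (x : I) : ℝ :=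
  h (B.φ x).1 * (B.weight (B.block x) (B.φ x).1 / (B.π.real {B.block x} * |(B.φ x).2.2|))

/-- The lower end of the window of values in which the `k`-th block is measured. -/
noncomputable def base (k : ℕ) : ℝ := (k + 1) / B.π.real {k}

/-- The values of the `k`-th block are truncated at this level; the truncation starts at
`base k * exp (k + 1)`. -/
noncomputable def level (k : ℕ) : ℝ := B.base k * Real.exp (2 * (k + 1))

/-- The function on `[0,1]` representing `h`: its spread-out version, truncated on the `k`-th block
at `level k` by a cut-off of logarithmic slope `1 / (k + 1)`. -/
noncomputable def code (h : Ω → ℝ) (x : I) : ℝ :=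
  slowTrunc ((B.block x : ℝ) + 1)⁻¹ (Real.log (B.level (B.block x))) (B.spread h x)

theorem base_pos (k : ℕ) : 0 < B.base k := div_pos (by positivity) (B.pos k)

theorem level_pos (k : ℕ) : 0 < B.level k := mul_pos (B.base_pos k) (Real.exp_pos _)

theorem measurable_block : Measurable B.block := B.measurable_φ.snd.fst

theorem measurable_spread {h : Ω → ℝ} (hh : Measurable h) : Measurable (B.spread h) := by
  have h1 : Measurable fun z : Ω × ℕ => B.weight z.2 z.1 :=
    measurable_from_prod_countable_left fun k =>
      B.measurable_v (Nat.unpair k).1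
  have h2 : Measurable fun x : I => B.weight (B.block x) (B.φ x).1 :=
    h1.comp (B.measurable_φ.fst.prodMk B.measurable_block)
  have h3 : Measurable fun x : I => B.π.real {B.block x} :=
    (measurable_of_countable fun k => B.π.real {k}).comp B.measurable_block
  exact (hh.comp B.measurable_φ.fst).mul
    (h2.coe_nnreal_real.div (h3.mul B.measurable_φ.snd.snd.abs))

theorem abs_spread (h : Ω → ℝ) (x : I) : |B.spread h x| =
    |h (B.φ x).1 * B.weight (B.block x) (B.φ x).1 / (B.π.real {B.block x} * (B.φ x).2.2)| := by
  rw [spread, ← mul_div_assoc, abs_div, abs_div, abs_mul (B.π.real _), abs_abs, ← abs_mul]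

theorem measurable_code {h : Ω → ℝ} (hh : Measurable h) : Measurable (B.code h) := by
  have h1 : Measurable fun z : ℝ × ℕ =>
      slowTrunc ((z.2 : ℝ) + 1)⁻¹ (Real.log (B.level z.2)) z.1 :=
    measurable_from_prod_countable_left fun k =>
      slowTrunc.measurable ((k : ℝ) + 1)⁻¹ (Real.log (B.level k))
  exact h1.comp ((B.measurable_spread hh).prodMk B.measurable_block)

theorem abs_code_le_level (h : Ω → ℝ) (x : I) : |B.code h x| ≤ B.level (B.block x) := by
  refine (slowTrunc.abs_le_exp (by positivity) _).trans_eq ?_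
  rw [Real.exp_log (B.level_pos _)]

theorem abs_code_le_spread (h : Ω → ℝ) (x : I) : |B.code h x| ≤ |B.spread h x| :=
  slowTrunc.abs_le_abs _

theorem tendsto_level_mul_tail :
    Filter.Tendsto (fun k => B.level k * volume.real {x | k < B.block x}) Filter.atTop (𝓝 0) := by
  refine B.tail.congr fun k => ?_
  have h1 : (volume : Measure I).real {x | k < B.block x} = B.π.real (Ioi k) := by
    have h2 : {x | k < B.block x} = B.φ ⁻¹' (univ ×ˢ (Ioi k ×ˢ univ)) := by
      ext x; simp [block]
    rw [measureReal_def, h2, ← Measure.map_apply B.measurable_φ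
      (MeasurableSet.univ.prod (measurableSet_Ioi.prod MeasurableSet.univ)), B.map_φ, blockMeasure,
      Measure.prod_prod, Measure.prod_prod, measure_univ, measure_univ, one_mul, mul_one,
      measureReal_def]
  rw [h1, level, base]; ring

theorem mul_measure_spread_le {h : Ω → ℝ} (hh : Measurable h) {M : ℝ} (hM : 0 ≤ M) (k : ℕ)
    (hint : ∫⁻ x, ‖h x‖ₑ * B.weight k x ∂B.P ≤ ENNReal.ofReal M) {c : ℝ} (hc : 0 < c) :
    c * (volume : Measure I).real {x | B.block x = k ∧ c < |B.spread h x|} ≤ M := by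
  have hu : Measurable fun x => h x * B.weight k x := hh.mul (B.measurable_v _).coe_nnreal_real
  have h1 := mul_blockMeasure_lt_le (P := B.P) hu (B.pos k) hc
  have hm : MeasurableSet {y : Ω × ℕ × ℝ |
      y.2.1 = k ∧ c < |h y.1 * B.weight k y.1 / (B.π.real {k} * y.2.2)|} := by
    have hF : Measurable fun y : Ω × ℕ × ℝ => h y.1 * B.weight k y.1 / (B.π.real {k} * y.2.2) :=
      (hu.comp measurable_fst).div (by fun_prop)
    exact (measurableSet_eq_fun (by fun_prop) measurable_const).inter
      (measurableSet_lt measurable_const hF.abs)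
  rw [← B.map_φ, Measure.map_apply B.measurable_φ hm] at h1
  have h2 : B.φ ⁻¹' {y : Ω × ℕ × ℝ |
      y.2.1 = k ∧ c < |h y.1 * B.weight k y.1 / (B.π.real {k} * y.2.2)|} =
      {x | B.block x = k ∧ c < |B.spread h x|} := by
    ext x
    change (B.block x = k ∧ _) ↔ _
    refine and_congr_right fun hx => ?_
    rw [B.abs_spread, hx]
  have h3 : ∫⁻ x, ENNReal.ofReal |h x * B.weight k x| ∂B.P ≤ ENNReal.ofReal M := by
    refine le_trans (le_of_eq (lintegral_congr fun x => ?_)) hint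
    rw [← Real.enorm_eq_ofReal_abs, enorm_mul]
    simp
  rw [h2, ← ofReal_measureReal, ← ENNReal.ofReal_mul hc.le] at h1
  exact (ENNReal.ofReal_le_ofReal_iff hM).1 (h1.trans h3)

theorem ae_fst {p : Ω → Prop} (hp : ∀ᵐ x ∂μ, p x) : ∀ᵐ x : I, p (B.φ x).1 := by
  have h1 : Measure.QuasiMeasurePreserving B.φ volume (blockMeasure B.P B.π) :=
    ⟨B.measurable_φ, B.map_φ.absolutelyContinuous⟩
  exact (Measure.quasiMeasurePreserving_fst.comp h1).ae (B.absolutelyContinuous.ae_le hp)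

theorem lintegral_weight_le {f : Ω →ₘ[μ] ℝ} (hf : f ∈ X.carrier) (k : ℕ) :
    ∫⁻ x, ‖f x‖ₑ * B.weight k x ∂B.P ≤ ENNReal.ofReal (X.nrm f) := by
  rw [← B.iSup_eq f hf]
  exact le_iSup (fun n => ∫⁻ x, ‖f x‖ₑ * B.v n x ∂B.P) _

theorem exists_forall_ge_mul_measure_code_le {f : Ω →ₘ[μ] ℝ} (hf : f ∈ X.carrier) :
    ∀ ε > 0, ∃ c₀, 0 < c₀ ∧ ∀ c ≥ c₀,
      c * (volume : Measure I).real {x | c < |B.code f x|} ≤ X.nrm f + ε := by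
  refine WeakL1.exists_forall_ge_mul_measure_le (R := fun _ => X.nrm f) zero_le_one
    (fun k => (B.level_pos k).le) (fun x => ?_) B.tendsto_level_mul_tail (fun k c hc => ?_)
    (fun ε hε => Filter.Eventually.of_forall fun k => by linarith) (X.nrm_nonneg f hf)
  · rw [one_mul]; exact B.abs_code_le_level _ _
  · refine le_trans ?_ (B.mul_measure_spread_le f.measurable (X.nrm_nonneg f hf) k
      (B.lintegral_weight_le hf k) hc)
    exact mul_le_mul_of_nonneg_left (measureReal_mono fun x hx =>
      ⟨hx.1, lt_of_lt_of_le hx.2 (B.abs_code_le_spread _ _)⟩) hc.le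

/-- The element of Weak `L¹[0,1]` representing `f`. It depends linearly on `f` only modulo the null
space of the envelope norm. -/
noncomputable def toWeakL1 (f : X.Elem) : WeakL1 (volume : Measure I) :=
  ⟨AEEqFun.mk (B.code f.1) (B.measurable_code f.1.measurable).aestronglyMeasurable, by
    obtain ⟨c₀, h0, h⟩ := B.exists_forall_ge_mul_measure_code_le f.2 1 one_pos
    exact WeakL1.weakQuasiNorm_lt_top_of_eventually (AEEqFun.coeFn_mk _ _) h0 h⟩

theorem toWeakL1_ae (f : X.Elem) : (B.toWeakL1 f).1 =ᵐ[volume] B.code f.1 :=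
  AEEqFun.coeFn_mk _ _

theorem norm_toWeakL1_le (f : X.Elem) : ‖B.toWeakL1 f‖ ≤ ‖f‖ :=
  WeakL1.norm_le_of_eventually (B.measurable_code f.1.measurable) (B.toWeakL1_ae f)
    (norm_nonneg f) (B.exists_forall_ge_mul_measure_code_le f.2)

end NormingBlocks

end KotheSpace

namespace KotheSpace

variable {Ω : Type*} [MeasurableSpace Ω] {μ : Measure Ω}

namespace NormingBlocks

variable {X : KotheSpace μ} (B : X.NormingBlocks)

/-! ### Linearity and lattice operations modulo the null space -/

theorem spread_add (f g : Ω → ℝ) (x : I) :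
    B.spread (fun z => f z + g z) x = B.spread f x + B.spread g x := add_mul _ _ _

theorem spread_const_mul (a : ℝ) (f : Ω → ℝ) (x : I) :
    B.spread (fun z => a * f z) x = a * B.spread f x := mul_assoc _ _ _

theorem spread_factor_nonneg (x : I) :
    0 ≤ (B.weight (B.block x) (B.φ x).1 : ℝ) / (B.π.real {B.block x} * |(B.φ x).2.2|) := by
  positivity

theorem spread_max (f g : Ω → ℝ) (x : I) :
    B.spread (fun z => max (f z) (g z)) x = max (B.spread f x) (B.spread g x) :=
  max_mul_of_nonneg _ _ (B.spread_factor_nonneg x)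

theorem spread_min (f g : Ω → ℝ) (x : I) :
    B.spread (fun z => min (f z) (g z)) x = min (B.spread f x) (B.spread g x) :=
  min_mul_of_nonneg _ _ (B.spread_factor_nonneg x)

theorem spread_abs (f : Ω → ℝ) (x : I) : B.spread (fun z => |f z|) x = |B.spread f x| := by
  rw [spread, spread, abs_mul, abs_of_nonneg (B.spread_factor_nonneg x)]

theorem code_congr {f g : Ω → ℝ} (h : f =ᵐ[μ] g) : B.code f =ᵐ[volume] B.code g := by
  filter_upwards [B.ae_fst h] with x hx
  rw [code, code, spread, spread, hx]

/-- A function which on the `k`-th block is of the order of `1 / (k + 1)` times an untruncated one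
belongs to the null space. -/
theorem norm_eq_zero_of_abs_le {G : WeakL1 (volume : Measure I)} {g : I → ℝ} (hg : Measurable g)
    (hG : G.1 =ᵐ[volume] g) {C : ℝ} (hC : 0 ≤ C) (hgC : ∀ x, |g x| ≤ C * B.level (B.block x))
    {h : Ω → ℝ} (hh : Measurable h) {M : ℝ} (hM : 0 ≤ M)
    (hint : ∀ k, ∫⁻ x, ‖h x‖ₑ * B.weight k x ∂B.P ≤ ENNReal.ofReal M)
    (hgh : ∀ x, |g x| ≤ ((B.block x : ℝ) + 1)⁻¹ * |B.spread h x|) : ‖G‖ = 0 := by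
  refine le_antisymm ?_ (norm_nonneg _)
  refine WeakL1.norm_le_of_eventually hg hG le_rfl
    (WeakL1.exists_forall_ge_mul_measure_le (R := fun k => M * ((k : ℝ) + 1)⁻¹) hC
      (fun k => (B.level_pos k).le) hgC B.tendsto_level_mul_tail (fun k c hc => ?_) ?_ le_rfl)
  · have hk : (0 : ℝ) < (k : ℝ) + 1 := by positivity
    have h1 := B.mul_measure_spread_le hh hM k (hint k) (mul_pos hk hc)
    have h2 : (volume : Measure I).real {x | B.block x = k ∧ c < |g x|} ≤
        (volume : Measure I).real {x | B.block x = k ∧ (k + 1) * c < |B.spread h x|} := by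
      refine measureReal_mono fun x hx => ⟨hx.1, ?_⟩
      have h3 : c < |g x| := hx.2
      have h4 := h3.trans_le (hgh x)
      have h5 : B.block x = k := hx.1
      rw [h5] at h4
      rwa [← div_eq_inv_mul, lt_div_iff₀' hk] at h4
    rw [← div_eq_mul_inv, le_div_iff₀ hk]
    calc _ = (k + 1) * c * (volume : Measure I).real {x | B.block x = k ∧ c < |g x|} := by ring
      _ ≤ _ := by gcongr
      _ ≤ M := h1
  · intro ε hε
    have h1 : Filter.Tendsto (fun k : ℕ => M * ((k : ℝ) + 1)⁻¹) Filter.atTop (𝓝 (M * 0)) := by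
      simpa only [one_div] using (tendsto_one_div_add_atTop_nhds_zero_nat (𝕜 := ℝ)).const_mul M
    rw [mul_zero] at h1
    exact h1.eventually_le_const (by linarith)

theorem lintegral_abs_add_abs_le (f g : X.Elem) (k : ℕ) :
    ∫⁻ x, ‖(|f.1 x| + |g.1 x|)‖ₑ * B.weight k x ∂B.P ≤ ENNReal.ofReal (‖f‖ + ‖g‖) := by
  rw [ENNReal.ofReal_add (norm_nonneg _) (norm_nonneg _)]
  refine le_trans ?_ (add_le_add (B.lintegral_weight_le f.2 k) (B.lintegral_weight_le g.2 k))
  have hm : Measurable fun x => ‖f.1 x‖ₑ * (B.weight k x : ℝ≥0∞) :=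
    f.1.measurable.enorm.mul (B.measurable_v _).coe_nnreal_ennreal
  refine le_trans ?_ (lintegral_add_left hm fun x => ‖g.1 x‖ₑ * (B.weight k x : ℝ≥0∞)).le
  refine lintegral_mono fun x => ?_
  rw [← add_mul]
  gcongr
  refine (enorm_add_le _ _).trans ?_
  simp

theorem abs_spread_abs_add_abs (f g : Ω → ℝ) (x : I) :
    |B.spread (fun z => |f z| + |g z|) x| = |B.spread f x| + |B.spread g x| := by
  rw [spread_add, spread_abs, spread_abs, abs_of_nonneg (by positivity)]

/-- If `H` differs from the representative of `s` by an error relatively small with respect to the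
representatives of `f` and `g`, then both have the same class in the envelope. -/
theorem norm_toWeakL1_sub_eq_zero {f g s : X.Elem} {H : WeakL1 (volume : Measure I)}
    {u : I → ℝ} {t : Ω → ℝ} (ht : Measurable t) (hst : s.1 =ᵐ[μ] t) (hu : Measurable u)
    (hH : H.1 =ᵐ[volume] u) (hu2 : ∀ x, |u x| ≤ 2 * B.level (B.block x))
    (herr : ∀ x, |B.code t x - u x| ≤
      ((B.block x : ℝ) + 1)⁻¹ * (|B.spread f.1 x| + |B.spread g.1 x|)) :
    ‖B.toWeakL1 s - H‖ = 0 := by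
  refine B.norm_eq_zero_of_abs_le (g := fun x => B.code t x - u x) (C := 3)
    ((B.measurable_code ht).sub hu) ?_ (by norm_num) (fun x => ?_)
    (f.1.measurable.abs.add g.1.measurable.abs)
    (add_nonneg (norm_nonneg f) (norm_nonneg g)) (B.lintegral_abs_add_abs_le f g)
    (fun x => (herr x).trans_eq ?_)
  · filter_upwards [WeakL1.coe_sub_ae (B.toWeakL1 s) H, B.toWeakL1_ae s, B.code_congr hst, hH]
      with x h1 h2 h3 h4
    rw [h1, h2, h3, h4]
  · have h1 := abs_sub (B.code t x) (u x)
    have h2 := B.abs_code_le_level t x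
    linarith [hu2 x]
  · exact congrArg _ (B.abs_spread_abs_add_abs f.1 g.1 x).symm

theorem norm_toWeakL1_add (f g : X.Elem) :
    ‖B.toWeakL1 (f + g) - (B.toWeakL1 f + B.toWeakL1 g)‖ = 0 := by
  refine B.norm_toWeakL1_sub_eq_zero (f := f) (g := g) (t := fun z => f.1 z + g.1 z)
    (u := fun x => B.code f.1 x + B.code g.1 x) (f.1.measurable.add g.1.measurable)
    (AEEqFun.coeFn_add f.1 g.1)
    ((B.measurable_code f.1.measurable).add (B.measurable_code g.1.measurable)) ?_ (fun x => ?_)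
    (fun x => ?_)
  · filter_upwards [AEEqFun.coeFn_add (B.toWeakL1 f).1 (B.toWeakL1 g).1, B.toWeakL1_ae f,
      B.toWeakL1_ae g] with x h1 h2 h3
    rw [← h2, ← h3]; exact h1
  · linarith [abs_add_le (B.code f.1 x) (B.code g.1 x), B.abs_code_le_level f.1 x,
      B.abs_code_le_level g.1 x]
  · rw [← sub_sub, code, spread_add]
    exact slowTrunc.abs_add_sub_le (by positivity) _ _

theorem norm_toWeakL1_sup (f g : X.Elem) :
    ‖B.toWeakL1 (f ⊔ g) - B.toWeakL1 f ⊔ B.toWeakL1 g‖ = 0 := by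
  refine B.norm_toWeakL1_sub_eq_zero (f := f) (g := g) (t := fun z => max (f.1 z) (g.1 z))
    (u := fun x => max (B.code f.1 x) (B.code g.1 x)) (f.1.measurable.max g.1.measurable)
    (AEEqFun.coeFn_sup f.1 g.1)
    ((B.measurable_code f.1.measurable).max (B.measurable_code g.1.measurable)) ?_ (fun x => ?_)
    (fun x => ?_)
  · filter_upwards [AEEqFun.coeFn_sup (B.toWeakL1 f).1 (B.toWeakL1 g).1, B.toWeakL1_ae f,
      B.toWeakL1_ae g] with x h1 h2 h3
    rw [← h2, ← h3]; exact h1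
  · exact abs_max_le_max_abs_abs.trans (max_le
      (by linarith [B.abs_code_le_level f.1 x, B.level_pos (B.block x)])
      (by linarith [B.abs_code_le_level g.1 x, B.level_pos (B.block x)]))
  · rw [code, spread_max]
    exact slowTrunc.abs_max_sub_le (by positivity) _ _

theorem norm_toWeakL1_inf (f g : X.Elem) :
    ‖B.toWeakL1 (f ⊓ g) - B.toWeakL1 f ⊓ B.toWeakL1 g‖ = 0 := by
  refine B.norm_toWeakL1_sub_eq_zero (f := f) (g := g) (t := fun z => min (f.1 z) (g.1 z))
    (u := fun x => min (B.code f.1 x) (B.code g.1 x)) (f.1.measurable.min g.1.measurable)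
    (AEEqFun.coeFn_inf f.1 g.1)
    ((B.measurable_code f.1.measurable).min (B.measurable_code g.1.measurable)) ?_ (fun x => ?_)
    (fun x => ?_)
  · filter_upwards [AEEqFun.coeFn_inf (B.toWeakL1 f).1 (B.toWeakL1 g).1, B.toWeakL1_ae f,
      B.toWeakL1_ae g] with x h1 h2 h3
    rw [← h2, ← h3]; exact h1
  · exact abs_min_le_max_abs_abs.trans (max_le
      (by linarith [B.abs_code_le_level f.1 x, B.level_pos (B.block x)])
      (by linarith [B.abs_code_le_level g.1 x, B.level_pos (B.block x)]))
  · rw [code, spread_min]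
    exact slowTrunc.abs_min_sub_le (by positivity) _ _

theorem norm_toWeakL1_smul (a : ℝ) (f : X.Elem) :
    ‖B.toWeakL1 (a • f) - a • B.toWeakL1 f‖ = 0 := by
  have hsub : (B.toWeakL1 (a • f) - a • B.toWeakL1 f).1 =ᵐ[volume]
      fun x => B.code (fun z => a * f.1 z) x - a * B.code f.1 x := by
    filter_upwards [WeakL1.coe_sub_ae (B.toWeakL1 (a • f)) (a • B.toWeakL1 f),
      B.toWeakL1_ae (a • f), B.toWeakL1_ae f, AEEqFun.coeFn_smul a (B.toWeakL1 f).1,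
      B.code_congr (AEEqFun.coeFn_smul a f.1)] with x h1 h2 h3 h4 h5
    have h6 : (a • B.toWeakL1 f).1 x = a * B.code f.1 x := by
      rw [← h3]; exact h4
    rw [h1, h2, h6]
    exact congrArg (· - a * B.code f.1 x) h5
  rcases eq_or_ne a 0 with rfl | ha
  · refine WeakL1.norm_eq_zero_of_abs_le (C := 0) ?_
    filter_upwards [hsub] with x hx
    rw [hx, code, spread_const_mul]
    simp
  have hl : 0 ≤ |a| * |(Real.log |a|)| := by positivity
  refine B.norm_eq_zero_of_abs_le (C := 1 + |a|)
    (g := fun x => B.code (fun z => a * f.1 z) x - a * B.code f.1 x)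
    (h := fun z => (|a| * |(Real.log |a|)|) * f.1 z) (M := (|a| * |(Real.log |a|)|) * ‖f‖)
    ((B.measurable_code (f.1.measurable.const_mul a)).sub
      ((B.measurable_code f.1.measurable).const_mul a)) hsub (by positivity) (fun x => ?_)
    (f.1.measurable.const_mul _) (by positivity) (fun k => ?_) (fun x => ?_)
  · have h1 := abs_sub (B.code (fun z => a * f.1 z) x) (a * B.code f.1 x)
    have h2 := B.abs_code_le_level (fun z => a * f.1 z) x
    have h3 : |a * B.code f.1 x| ≤ |a| * B.level (B.block x) := by
      rw [abs_mul]
      exact mul_le_mul_of_nonneg_left (B.abs_code_le_level _ _) (abs_nonneg a)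
    linarith
  · rw [ENNReal.ofReal_mul hl]
    refine le_trans (le_of_eq ?_) (mul_le_mul_right (B.lintegral_weight_le f.2 k) _)
    rw [← lintegral_const_mul' _ _ ENNReal.ofReal_ne_top]
    refine lintegral_congr fun x => ?_
    rw [enorm_mul, Real.enorm_of_nonneg hl, mul_assoc]
  · rw [spread_const_mul, abs_mul (|a| * _), abs_of_nonneg hl, code, spread_const_mul]
    exact slowTrunc.abs_mul_sub_le (by positivity) ha _

/-! ### The norm of the representing functions -/

theorem code_eq_spread (h : Ω → ℝ) {x : I}
    (hx : |B.spread h x| ≤ B.base (B.block x) * Real.exp (B.block x + 1)) :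
    B.code h x = B.spread h x := by
  refine slowTrunc.eq_self (by positivity) (hx.trans_eq ?_)
  rw [inv_inv, Real.exp_sub, Real.exp_log (B.level_pos _), level, mul_div_assoc, ← Real.exp_sub]
  congr 2; ring

theorem mul_lintegral_le_lintegral_window {h : Ω → ℝ} (hh : Measurable h) (k : ℕ) :
    ENNReal.ofReal (k + 1) * ∫⁻ x in {x | |h x * B.weight k x| ≤ k + 1},
        ENNReal.ofReal |h x * B.weight k x| ∂B.P ≤
      ∫⁻ x in {x : I | B.base k < |B.code h x| ∧ |B.code h x| < B.base k * Real.exp (k + 1)},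
        ENNReal.ofReal |B.code h x| := by
  have hu : Measurable fun x => h x * B.weight k x := hh.mul (B.measurable_v _).coe_nnreal_real
  have h1 := mul_lintegral_le_blockMeasure (P := B.P) hu (B.pos k) (B.base_pos k)
    (b := B.base k * Real.exp (k + 1))
    (le_mul_of_one_le_right (B.base_pos k).le (Real.one_le_exp (by positivity)))
  rw [mul_div_cancel_left₀ _ (B.base_pos k).ne', Real.log_exp,
    show B.π.real {k} * B.base k = k + 1 from mul_div_cancel₀ _ (B.pos k).ne'] at h1
  refine h1.trans ?_
  have hF : Measurable fun y : Ω × ℕ × ℝ => |h y.1 * B.weight k y.1 / (B.π.real {k} * y.2.2)| :=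
    ((hu.comp measurable_fst).div (by fun_prop)).abs
  have hm : MeasurableSet {y : Ω × ℕ × ℝ | y.2.1 = k ∧
      B.base k < |h y.1 * B.weight k y.1 / (B.π.real {k} * y.2.2)| ∧
      |h y.1 * B.weight k y.1 / (B.π.real {k} * y.2.2)| < B.base k * Real.exp (k + 1)} :=
    (measurableSet_eq_fun (by fun_prop) measurable_const).inter
      ((measurableSet_lt measurable_const hF).inter (measurableSet_lt hF measurable_const))
  rw [← B.map_φ, setLIntegral_map hm hF.ennreal_ofReal B.measurable_φ,
    ← lintegral_indicator (B.measurable_φ hm)]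
  refine le_trans (lintegral_mono fun x => ?_) (lintegral_indicator_le _ _)
  by_cases hx : x ∈ B.φ ⁻¹' {y : Ω × ℕ × ℝ | y.2.1 = k ∧
      B.base k < |h y.1 * B.weight k y.1 / (B.π.real {k} * y.2.2)| ∧
      |h y.1 * B.weight k y.1 / (B.π.real {k} * y.2.2)| < B.base k * Real.exp (k + 1)}
  swap
  · rw [indicator_of_notMem hx]; exact zero_le
  obtain ⟨hxk, hxa, hxb⟩ := hx
  have hxk' : B.block x = k := hxk
  have hs : |h (B.φ x).1 * B.weight k (B.φ x).1 / (B.π.real {k} * (B.φ x).2.2)| =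
      |B.code h x| := by
    have h2 := B.abs_spread h x
    rw [hxk'] at h2
    rw [B.code_eq_spread, h2]
    rw [hxk', h2]; exact hxb.le
  rw [indicator_of_mem (by exact ⟨hxk, hxa, hxb⟩), indicator_of_mem (by
    rw [hs] at hxa hxb; exact ⟨hxa, hxb⟩), hs]

/-- Integrating over the `k`-th window of values recovers, as `k → ∞` along the blocks carrying the
weight `v n`, the whole integral of `|f| v n`. -/
theorem le_norm_toWeakL1 (f : X.Elem) : ‖f‖ ≤ ‖B.toWeakL1 f‖ := by
  refine le_of_forall_gt_imp_ge_of_dense fun r hr => ?_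
  have hr0 : 0 ≤ r := (norm_nonneg _).trans hr.le
  obtain ⟨C, hC⟩ := WeakL1.exists_setLIntegral_window_le (B.toWeakL1 f)
    (B.measurable_code f.1.measurable) (B.toWeakL1_ae f) hr
  have hk (k : ℕ) : ∫⁻ x in {x | |f.1 x * B.weight k x| ≤ k + 1},
      ENNReal.ofReal |f.1 x * B.weight k x| ∂B.P ≤
        ENNReal.ofReal (r + C * (1 / ((k : ℝ) + 1))) := by
    have hk0 : (0 : ℝ) < k + 1 := by positivity
    have h1 := (B.mul_lintegral_le_lintegral_window f.1.measurable k).trans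
      (hC _ _ (B.base_pos k)
        (le_mul_of_one_le_right (B.base_pos k).le (Real.one_le_exp hk0.le)))
    rw [mul_div_cancel_left₀ _ (B.base_pos k).ne', Real.log_exp,
      show r * ((k : ℝ) + 1) + C = (k + 1) * (r + C * (1 / ((k : ℝ) + 1))) by field_simp,
      ENNReal.ofReal_mul hk0.le] at h1
    exact (ENNReal.mul_le_mul_iff_right (ENNReal.ofReal_pos.2 hk0).ne' ENNReal.ofReal_ne_top).1 h1
  change X.nrm f.1 ≤ r
  rw [← ENNReal.ofReal_le_ofReal_iff hr0, ← B.iSup_eq f.1 f.2]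
  refine iSup_le fun n => ?_
  -- The blocks `Nat.pair n j` all carry the weight `v n`, and see more and more of `f v n`.
  let k : ℕ → ℕ := fun j => Nat.pair n j
  have hktop : Filter.Tendsto k Filter.atTop Filter.atTop :=
    Filter.tendsto_atTop_mono (fun j => Nat.right_le_pair n j) Filter.tendsto_id
  have hw (j : ℕ) : B.weight (k j) = B.v n := by
    simp [weight, k]
  have hu : Measurable fun x => f.1 x * B.v n x :=
    f.1.measurable.mul (B.measurable_v _).coe_nnreal_real
  have hm (j : ℕ) : MeasurableSet {x | |f.1 x * B.v n x| ≤ k j + 1} :=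
    measurableSet_le hu.abs measurable_const
  let F : ℕ → Ω → ℝ≥0∞ := fun j => {x | |f.1 x * B.v n x| ≤ k j + 1}.indicator
    fun x => ENNReal.ofReal |f.1 x * B.v n x|
  have hlim (x : Ω) : Filter.Tendsto (fun j => F j x) Filter.atTop
      (𝓝 (ENNReal.ofReal |f.1 x * B.v n x|)) := by
    refine tendsto_const_nhds.congr' ?_
    obtain ⟨K, hK⟩ := exists_nat_ge |f.1 x * B.v n x|
    filter_upwards [hktop.eventually_ge_atTop K] with j hj
    have h1 : |f.1 x * B.v n x| ≤ k j + 1 := by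
      have : (K : ℝ) ≤ k j := Nat.cast_le.2 hj
      linarith
    exact (indicator_of_mem (show x ∈ {x | |f.1 x * B.v n x| ≤ k j + 1} from h1)
      fun x => ENNReal.ofReal |f.1 x * B.v n x|).symm
  have hrlim : Filter.Tendsto (fun j => ENNReal.ofReal (r + C * (1 / ((k j : ℝ) + 1))))
      Filter.atTop (𝓝 (ENNReal.ofReal r)) := by
    refine ENNReal.tendsto_ofReal ?_
    have h1 := ((tendsto_one_div_add_atTop_nhds_zero_nat (𝕜 := ℝ)).comp hktop).const_mul C
    simpa using h1.const_add r
  calc ∫⁻ x, ‖f.1 x‖ₑ * B.v n x ∂B.P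
      = ∫⁻ x, Filter.liminf (fun j => F j x) Filter.atTop ∂B.P := by
        refine lintegral_congr fun x => ?_
        rw [(hlim x).liminf_eq, ← Real.enorm_eq_ofReal_abs, enorm_mul]
        simp
    _ ≤ Filter.liminf (fun j => ∫⁻ x, F j x ∂B.P) Filter.atTop :=
        lintegral_liminf_le fun j => hu.abs.ennreal_ofReal.indicator (hm j)
    _ ≤ Filter.liminf (fun j => ENNReal.ofReal (r + C * (1 / ((k j : ℝ) + 1)))) Filter.atTop := by
        refine Filter.liminf_le_liminf (Filter.Eventually.of_forall fun j => ?_)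
        have h1 := hk (k j)
        rw [hw] at h1
        rwa [lintegral_indicator (hm j)]
    _ = ENNReal.ofReal r := hrlim.liminf_eq

/-! ### The embedding -/

theorem mk_eq_mk_of_norm_sub {f g : WeakL1 (volume : Measure I)} (h : ‖f - g‖ = 0) :
    (SeparationQuotient.mk f : W) = SeparationQuotient.mk g :=
  SeparationQuotient.mk_eq_mk.2 (NormedEnvelope.inseparable_iff.2 h)

/-- The isometric embedding of a Köthe space into the normed envelope of Weak `L¹[0,1]`. -/
noncomputable def toEnvelope : X.Elem →ₗᵢ[ℝ] W where
  toFun f := SeparationQuotient.mk (B.toWeakL1 f)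
  map_add' f g := mk_eq_mk_of_norm_sub (B.norm_toWeakL1_add f g)
  map_smul' a f := mk_eq_mk_of_norm_sub (B.norm_toWeakL1_smul a f)
  norm_map' f := (SeparationQuotient.norm_mk _).trans
    (le_antisymm (B.norm_toWeakL1_le f) (B.le_norm_toWeakL1 f))

theorem toEnvelope_sup (f g : X.Elem) :
    B.toEnvelope (f ⊔ g) = B.toEnvelope f ⊔ B.toEnvelope g :=
  mk_eq_mk_of_norm_sub (B.norm_toWeakL1_sup f g)

theorem toEnvelope_inf (f g : X.Elem) :
    B.toEnvelope (f ⊓ g) = B.toEnvelope f ⊓ B.toEnvelope g :=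
  mk_eq_mk_of_norm_sub (B.norm_toWeakL1_inf f g)

end NormingBlocks

/-- Every Köthe space with norming Köthe dual over a nonzero σ-finite measure on a standard Borel
space embeds into the normed envelope of Weak `L¹[0,1]`. -/
theorem isometricSublattice_of_dualNorming [StandardBorelSpace Ω] [SigmaFinite μ] (hμ : μ ≠ 0)
    (X : KotheSpace μ) (hX : X.DualNorming) : IsometricSublattice X.Elem W := by
  obtain ⟨B⟩ := nonempty_normingBlocks hμ X hX
  refine ⟨LinearMap.range B.toEnvelope.toLinearMap, ?_, B.toEnvelope.equivRange, fun f g =>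
    ⟨B.toEnvelope_sup f g, B.toEnvelope_inf f g⟩⟩
  rintro _ ⟨f, rfl⟩ _ ⟨g, rfl⟩
  exact ⟨⟨f ⊔ g, B.toEnvelope_sup f g⟩, ⟨f ⊓ g, B.toEnvelope_inf f g⟩⟩

end KotheSpace

theorem mainTheorem4 :
    (∀ X : KotheSpace halfLine, IsRIHalfLine X → IsometricSublattice X.Elem W) ∧
    (∀ X : KotheSpace (volume : Measure I), IsRIUnit X → IsometricSublattice X.Elem W) ∧
    (∀ X : KotheSpace (Measure.count : Measure ℕ), IsRINat X → IsometricSublattice X.Elem W) := by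
  refine ⟨fun X hX => ?_, fun X hX => ?_, fun X hX => ?_⟩
  · have : SigmaFinite halfLine := by
      refine SigmaFinite.of_map _ measurable_subtype_coe.aemeasurable ?_
      rw [halfLine, (MeasurableEmbedding.subtype_coe measurableSet_Ici).map_comap]
      infer_instance
    have : StandardBorelSpace (Ici (0 : ℝ)) := measurableSet_Ici.standardBorel
    refine KotheSpace.isometricSublattice_of_dualNorming (fun h0 => ?_) X hX.norming
    have h1 : halfLine univ = ∞ := by
      rw [halfLine, comap_subtype_coe_apply measurableSet_Ici, image_univ, Subtype.range_coe,
        Real.volume_Ici]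
    simp [h0] at h1
  · exact KotheSpace.isometricSublattice_of_dualNorming (IsProbabilityMeasure.ne_zero _) X
      hX.norming
  · exact KotheSpace.isometricSublattice_of_dualNorming (NeZero.ne _) X hX.norming
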